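/- Let $\alpha,\tilde\alpha>0$ and $\beta\ge 0$. Put $\alpha_i=\alpha$ for odd $i$ and $\alpha_i=\tilde\alpha$ for even $i$. Let $W_n=\{x\in\mathbb Z^n: x_1<\dots<x_n\}$ ($W_0$ is a one-point set). **Kernels.** For pairwise different $a_1,\dots,a_n>0$ and $b\ge 0$ define, for $x,y\in W_n$, $$P_n^{a,b}(x,y)=\frac{\det[a_i^{y_j}]_{i,j=1}^n}{\det[a_i^{x_j}]_{i,j=1}^n}\,\frac{\det[f_b(x_i-y_j)]_{i,j=1}^n}{\prod_{j=1}^n(1+b\,a_j)},\qquad f_b(m)=\delta_{m,0}+b\,\delta_{m,-1},$$ and, for $x\in W_n$, $y\in W_{n-1}$, with a virtual coordinate $y_n=\mathrm{virt}$, $$\Lambda^{n,a}_{n-1}(x,y)=\frac{\det[a_i^{y_j}]_{i,j=1}^{n-1}}{\det[a_i^{x_j}]_{i,j=1}^n}\,\frac{\det[g_n(x_i-y_j)]_{i,j=1}^n}{\prod_{j=1}^{n-1}(1-a_n/a_j)^{-1}},\qquad g_n(m)=a_n^m\mathbf 1_{m\ge 0},\quad g_n(x-\mathrm{virt})=a_n^x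 .$$ The limits of $P^{a,b}_n(x,y)$ and $\Lambda^{n,a}_{n-1}(x,y)$ as $(a_1,\dots,a_n)\to(\alpha_1,\dots,\alpha_n)$ through vectors with pairwise different entries exist. Denote them by $P_n^{(b)}$ and $\Lambda^n_{n-1}$, and put $P_n(\tau)=P_n^{(\beta)}$ for $\tau\ge 0$ and $P_n(\tau)=P_n^{(0)}$ for $\tau<0$. **Chain.** A configuration of $N\ge 1$ levels consists of $x^n\in W_{2n}$, $y^n\in W_{2n-1}$, $z^n\in W_{2n-2}$ for $1\le n\le N$ ($z^1$ is empty); such configurations encode the non-intersecting line ensembles of the Tower of size $N$. At time $0$ all vectors are packed: a vector of length $m$ equals $(-m,-m+1,\dots,-1)$. The step from time $t$ to time $t+1$ is as follows. * $z^{n}(t+1)=x^{n-1}(t)$ for $2\le n\le N$. * $y^n(t+1)$ has the law of the middle point of the two-step chain that first applies $P_{2n-1}(t-n+1)$ and then $\Lambda^{2n-1}_{2n-2}$, started at $y^n(t)$ and conditioned to end at $z^n(t+1)$. (For $n=1$: $y^1(t+1)$ has law $P_1(t)(y^1(t),\cdot)$.) * $x^n(t+1)$ has the law of the middle point of the two-step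 chain that first applies $P_{2n}(t-n+1)$ and then $\Lambda^{2n}_{2n-1}$, started at $x^n(t)$ and conditioned to end at $y^n(t+1)$. The updates are conditionally independent over $n$. The law of the line ensemble of the Tower of size $N$ is the law of the levels $1,\dots,N$ at time $t=N$. **Theorem.** For every $N\ge1$ this law is a probability measure, and there is a constant, which depends only on $N,\alpha,\tilde\alpha,\beta$, such that the probability of every configuration is $$\begin{aligned}\mathrm{const}\times{}&\det[\tilde\Psi^{2N}_i(x^N_j)]_{i,j=1}^{2N}\prod_{n=1}^{N}\Big(\det[\phi(x^n_i,y^n_j)]_{i,j=1}^{2n}\,\det[\phi(y^n_i,z^n_j)]_{i,j=1}^{2n-1}\Big)\\ &\times\prod_{n=2}^{N}\det[\tilde f(x^{n-1}_i-z^n_j)]_{i,j=1}^{2n-2}\;\prod_{n=1}^N F(x^n,y^n,z^n),\end{aligned}$$ where $y^n_{2n}=\mathrm{virt}$, $z^n_{2n-1}=\mathrm{virt}$, $\phi(x,y)=\mathbf 1_{y>x}$, $\phi(x,\mathrm{virt})=1$, $\tilde f(x)=\delta_{x,0}+\beta\,\delta_{x,1}$, $$\tilde\Psi^{2N}_i(x)=\frac1{2\pi\mathrm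 i}\oint_{\Gamma_0}(1-z)^{2N-i}z^{x+i-1}(1+\beta/z)\,\mathrm dz$$ ($\Gamma_0$ is a positively oriented circle around $0$), and $$F(x^n,y^n,z^n)=\prod_{i=1}^{2n}\tilde\alpha^{\,x^n_i}\prod_{j=1}^{2n-1}(\alpha/\tilde\alpha)^{y^n_j}\prod_{k=1}^{2n-2}(1/\alpha)^{z^n_k}.$$ -/

import Mathlib

open Filter Topology

noncomputable section

namespace TowerTiling

/-- The Weyl chamber `W_n` of strictly increasing integer vectors of length `n`. -/
abbrev W (n : ℕ) : Type := {x : Fin n → ℤ // StrictMono x}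

/-- The packed configuration `(-n, -n + 1, …, -1)` of `W_n`. -/
def packed (n : ℕ) : W n :=
  ⟨fun i => -(n : ℤ) + (i : ℕ), fun i j hij => by
    have h : (i : ℕ) < (j : ℕ) := hij
    show -(n : ℤ) + ((i : ℕ) : ℤ) < -(n : ℤ) + ((j : ℕ) : ℤ)
    omega⟩

/-- The coordinates of `y` followed by one virtual coordinate, which is written `none`. -/
def withVirt {n : ℕ} (y : W n) : Fin (n + 1) → Option ℤ :=
  Fin.snoc (α := fun _ => Option ℤ) (fun j => some (y.1 j)) none

/-- The determinant `det [a_i ^ {x_j}]`. -/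
def powDet {n : ℕ} (a : Fin n → ℝ) (x : W n) : ℝ :=
  Matrix.det (Matrix.of fun i j : Fin n => a i ^ x.1 j)

/-- `f(m) = δ_{m,0} + b δ_{m,-1}`. -/
def stepFun (b : ℝ) (m : ℤ) : ℝ :=
  (if m = 0 then 1 else 0) + b * (if m = -1 then 1 else 0)

/-- The transition kernel `P_n` on `W_n` with pairwise different vertical weights
`a_1, …, a_n` and diagonal weight `b`. -/
def genP {n : ℕ} (a : Fin n → ℝ) (b : ℝ) (x y : W n) : ℝ :=
  powDet a y / powDet a x *
    (Matrix.det (Matrix.of fun i j : Fin n => stepFun b (x.1 i - y.1 j)) /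
      ∏ j : Fin n, (1 + b * a j))

/-- `f(x - y) = w ^ (x - y)` if `y ≤ x` and `0` otherwise; `f(x - virt) = w ^ x`. -/
def linkFun (w : ℝ) (x : ℤ) : Option ℤ → ℝ
  | some y => if y ≤ x then w ^ (x - y) else 0
  | none => w ^ x

/-- The Markov link `Λ^{n+1}_n` from `W_{n+1}` to `W_n` with pairwise different vertical weights
`a_1, …, a_{n+1}`. -/
def genLink {n : ℕ} (a : Fin (n + 1) → ℝ) (x : W (n + 1)) (y : W n) : ℝ :=
  powDet (fun i : Fin n => a i.castSucc) y / powDet a x *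
    (Matrix.det (Matrix.of fun i j : Fin (n + 1) =>
        linkFun (a (Fin.last n)) (x.1 i) (withVirt y j)) /
      ∏ j : Fin n, (1 - a (Fin.last n) / a j.castSucc)⁻¹)

/-- The weights `(α, α', α, α', …)` of length `n` (so `α_1 = α_3 = … = α` and
`α_2 = α_4 = … = α'`). -/
def towerWeights (α α' : ℝ) (n : ℕ) : Fin n → ℝ :=
  fun i => if Even (i : ℕ) then α else α'

/-- Pairwise different weights that tend to `(α, α', α, α', …)`. -/
def towerLimit (α α' : ℝ) (n : ℕ) : Filter (Fin n → ℝ) :=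
  𝓝[{a | Function.Injective a}] (towerWeights α α' n)

/-- The kernel `P_n` in the limit of weights `(α, α', α, α', …)`. -/
def towerP (α α' : ℝ) {n : ℕ} (b : ℝ) (x y : W n) : ℝ :=
  limUnder (towerLimit α α' n) fun a => genP a b x y

/-- The link `Λ^{n+1}_n` in the limit of weights `(α, α', α, α', …)`. -/
def towerLink (α α' : ℝ) {n : ℕ} (x : W (n + 1)) (y : W n) : ℝ :=
  limUnder (towerLimit α α' (n + 1)) fun a => genLink a x y

/-- The diagonal weight at time `τ`: particles may move only from time `0` on. -/
def weightAt (β : ℝ) (τ : ℤ) : ℝ := if 0 ≤ τ then β else 0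

/-- The particles `x^{k+1}`, `y^{k+1}`, `z^{k+1}`, which have `2k + 2`, `2k + 1` and `2k`
coordinates. In particular `z^1` is the empty configuration. -/
structure Level (k : ℕ) where
  x : W (2 * k + 2)
  y : W (2 * k + 1)
  z : W (2 * k)

/-- Configurations of levels `1, …, N`; level `k + 1` is stored at index `k`. -/
abbrev Config (N : ℕ) : Type := (k : Fin N) → Level k

/-- The packed initial condition. -/
def packedConfig (N : ℕ) : Config N :=
  fun _ => ⟨packed _, packed _, packed _⟩

/-- The conditional law of the middle point `v` of the two-step chain `P ∘ Λ`
(first `P`, with diagonal weight `b`, then `Λ`) that starts in `u` and ends in `w`. -/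
def middle (α α' b : ℝ) {n : ℕ} (u : W (n + 1)) (w : W n) (v : W (n + 1)) : ℝ :=
  towerP α α' b u v * towerLink α α' v w /
    ∑' v' : W (n + 1), towerP α α' b u v' * towerLink α α' v' w

open Classical in
/-- The transition probability from the configuration `c` at time `t` to `c'` at time `t + 1`:
`z^{n+1}` becomes the old `x^n`; then, independently over `n`, `y^n` becomes the middle point of
`P_{2n-1}(t-n+1) ∘ Λ^{2n-1}_{2n-2}` between the old `y^n` and the new `z^n`, and `x^n` becomes the
middle point of `P_{2n}(t-n+1) ∘ Λ^{2n}_{2n-1}` between the old `x^n` and the new `y^n`.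
For `n = 1` the link `Λ^1_0` to the one-point set `W_0` is constant, so `y^1` moves by `P_1`. -/
def transition (α α' β : ℝ) {N : ℕ} (t : ℕ) (c c' : Config N) : ℝ :=
  (if ∀ (k : ℕ) (h : k + 1 < N), (c' ⟨k + 1, h⟩).z = (c ⟨k, Nat.lt_of_succ_lt h⟩).x
    then 1 else 0) *
  ∏ k : Fin N,
    (middle α α' (weightAt β ((t : ℤ) - (k : ℕ))) (c k).y (c' k).z (c' k).y *
      middle α α' (weightAt β ((t : ℤ) - (k : ℕ))) (c k).x (c' k).y (c' k).x)

open Classical in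
/-- The law at time `t` of levels `1, …, N` of the chain started from packed initial conditions. -/
def chainLaw (α α' β : ℝ) (N : ℕ) : ℕ → Config N → ℝ
  | 0, c => if c = packedConfig N then 1 else 0
  | t + 1, c => ∑' c₀ : Config N, chainLaw α α' β N t c₀ * transition α α' β t c₀ c

/-- The law of the line ensemble of the Tower of size `N`: the chain at time `N`. -/
def towerLaw (α α' β : ℝ) (N : ℕ) : Config N → ℝ := chainLaw α α' β N N

/-- `φ(x, y) = 1` if `y > x` and `0` otherwise; `φ(x, virt) = 1`. -/
def phi (x : ℤ) : Option ℤ → ℝ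
  | some y => if x < y then 1 else 0
  | none => 1

/-- `det [φ(x_i, y_j)]` for `x ∈ W_{n+1}`, `y ∈ W_n`, where `y_{n+1}` is virtual. -/
def phiDet {n : ℕ} (x : W (n + 1)) (y : W n) : ℝ :=
  Matrix.det (Matrix.of fun i j : Fin (n + 1) => phi (x.1 i) (withVirt y j))

/-- `f̃(m) = δ_{m,0} + β δ_{m,1}`. -/
def fTilde (β : ℝ) (m : ℤ) : ℝ :=
  (if m = 0 then 1 else 0) + β * (if m = 1 then 1 else 0)

/-- `det [f̃(x_i - z_j)]`. -/
def fTildeDet (β : ℝ) {n : ℕ} (x z : W n) : ℝ :=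
  Matrix.det (Matrix.of fun i j : Fin n => fTilde β (x.1 i - z.1 j))

/-- `Ψ̃_i(x) = (2πi)⁻¹ ∮ (1 - z) ^ (M - i) z ^ (x + i - 1) (1 + β / z) dz` around `0`,
for `1 ≤ i ≤ M`. -/
def psiTilde (β : ℝ) (M i : ℕ) (x : ℤ) : ℂ :=
  (2 * (Real.pi : ℂ) * Complex.I)⁻¹ *
    ∮ z in C(0, 1), (1 - z) ^ (M - i) * z ^ (x + (i : ℤ) - 1) * (1 + (β : ℂ) / z)

/-- `det [Ψ̃_i(x_j)]` with `i, j = 1, …, M`. -/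
def psiTildeDet (β : ℝ) {M : ℕ} (x : W M) : ℂ :=
  Matrix.det (Matrix.of fun i j : Fin M => psiTilde β M ((i : ℕ) + 1) (x.1 j))

/-- `F(x, y, z) = ∏ α' ^ {x_i} ∏ (α / α') ^ {y_j} ∏ (1 / α) ^ {z_k}`. -/
def weightF (α α' : ℝ) {k : ℕ} (l : Level k) : ℝ :=
  (∏ i, α' ^ l.x.1 i) * (∏ j, (α / α') ^ l.y.1 j) * ∏ m, (1 / α) ^ l.z.1 m

end TowerTiling

end

/-!
The kernels and the links are Doob transforms. By the branching rule `powDet_succ`, the determinant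
`powDet a x` is an alternating factor, which does not depend on `x`, times the generating function
`schur a x` of the sequences of interlacing vectors below `x`. The latter is continuous and positive
for positive weights, so the limits exist: `towerP` is `schur y / schur x` times a weight of
independent Bernoulli moves, and `towerLink` is `schur y / schur x` times a weight of interlacing
vectors (`towerP_eq`, `towerLink_eq`).

The two families commute, `P ∘ Λ = Λ ∘ P` (`step_link_comm`, `towerP_towerLink_comm`). Therefore
the normalization of `middle` is also the kernel that first goes down a link and then moves. Commutation
makes the kernels stochastic (`tsum_towerP`). It also shows that the chain preserves the following
form of the law (`configLaw`): down from `x` of the last level, the vectors `x`, `y`, `z` of a level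
are connected by links, and `z` of a level is connected to `x` of the level below by a move, with the
weight of the time at which the lower level made it. Indeed, summing the old `z` and then the old `y`
of a level produces exactly the normalizations of the two middle points (`tsum_level_step`), and the
old `x` of a level is the new `z` of the level above (`tsum_configLaw_transition`).

At time `N` the last level has made one move with weight `β`, from the packed vector, and all
moves between levels have weight `β`. In the product the Schur functions telescope, and what remains
are the weights of the moves and of the interlacing vectors. These are the determinants `fTildeDet`
and `phiDet` (`fTildeDet_eq`, `phiDet_eq`), because each determinant, after row operations in the
second case, has at most one nonzero term (`det_eq_prod_diag_of_ordered`), which gives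
`exists_configLaw_eq`. Finally, evaluating the integrals of powers of `z` shows that `psiTilde` is a
unitriangular combination of the steps from the packed vector (`psiTildeDet_eq`).
-/

noncomputable section

namespace TowerTiling

/-! ### Determinants -/

/-- A determinant in which the nonzero entries of two columns `i < j` are ordered: only the
identity permutation contributes. -/
theorem det_eq_prod_diag_of_ordered {n : ℕ} (A : Matrix (Fin n) (Fin n) ℝ)
    (h : ∀ i j, i < j → ∀ k l, A k i ≠ 0 → A l j ≠ 0 → k ≤ l) :
    A.det = ∏ i, A i i := by
  rw [Matrix.det_apply, Finset.sum_eq_single 1]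
  · simp
  · intro σ _ hσ
    by_contra hne
    apply hσ
    have hnz : ∀ i, A (σ i) i ≠ 0 := by
      intro i hi
      apply hne
      have h0 : ∏ i, A (σ i) i = 0 := Finset.prod_eq_zero (Finset.mem_univ i) hi
      exact (congrArg (fun r => Equiv.Perm.sign σ • r) h0).trans (smul_zero _)
    have hmono : StrictMono σ := fun i j hij =>
      lt_of_le_of_ne (h i j hij _ _ (hnz i) (hnz j)) (σ.injective.ne hij.ne)
    have : (⇑σ : Fin n → Fin n) = id := by
      have := Subsingleton.elim (hmono.orderIsoOfSurjective σ σ.surjective) (OrderIso.refl _)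
      funext i
      exact congrArg (fun e : Fin n ≃o Fin n => e i) this
    ext i
    simp [this]
  · simp

/-- Row operations that clear the last column, followed by expansion along it. -/
theorem det_clear_last_col {n : ℕ} (A : Matrix (Fin (n + 1)) (Fin (n + 1)) ℝ) (c : Fin n → ℝ)
    (hc : ∀ i : Fin n, A i.succ (Fin.last n) = c i * A i.castSucc (Fin.last n)) :
    A.det = (-1) ^ n * A 0 (Fin.last n) *
      Matrix.det (Matrix.of fun i j : Fin n =>
        A i.succ j.castSucc - c i * A i.castSucc j.castSucc) := by
  let B : Matrix (Fin (n + 1)) (Fin (n + 1)) ℝ := Matrix.of fun i j =>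
    Fin.cases (A 0 j) (fun i => A i.succ j - c i * A i.castSucc j) i
  have hAB : A.det = B.det :=
    Matrix.det_eq_of_forall_row_eq_smul_add_pred c (fun j => by simp [B])
      (fun i j => by simp [B])
  rw [hAB, Matrix.det_succ_column B (Fin.last n), Fin.sum_univ_succ, Finset.sum_eq_zero]
  · simp only [B, Matrix.of_apply, Fin.cases_zero, add_zero, Fin.val_zero, Fin.val_last, zero_add]
    congr 2
    ext i j
    simp [Fin.succAbove_last]
  · intro i _
    simp [B, hc]

theorem stepFun_eq_zero {b : ℝ} {m : ℤ} (h0 : m ≠ 0) (h1 : m ≠ -1) : stepFun b m = 0 := by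
  simp [stepFun, h0, h1]

theorem stepFun_support {b : ℝ} {m : ℤ} (h : stepFun b m ≠ 0) : m = 0 ∨ m = -1 := by
  by_contra hcon
  push Not at hcon
  exact h (stepFun_eq_zero hcon.1 hcon.2)

theorem stepFun_zero (b : ℝ) : stepFun b 0 = 1 := by simp [stepFun]

theorem stepFun_neg_one (b : ℝ) : stepFun b (-1) = b := by simp [stepFun]

/-- The matrix of the steps is ordered: its determinant is the product of the diagonal entries. -/
theorem det_stepFun {n : ℕ} (b : ℝ) (x y : W n) :
    Matrix.det (Matrix.of fun i j : Fin n => stepFun b (x.1 i - y.1 j)) =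
      ∏ i, stepFun b (x.1 i - y.1 i) := by
  apply det_eq_prod_diag_of_ordered
  intro i j hij k l hk hl
  have hy := y.2 hij
  have h1 := stepFun_support hk
  have h2 := stepFun_support hl
  exact x.2.le_iff_le.1 (by omega)

theorem stepFun_nonneg {b : ℝ} (hb : 0 ≤ b) (m : ℤ) : 0 ≤ stepFun b m := by
  unfold stepFun; positivity

theorem zpow_sum₀ {ι : Type*} {w : ℝ} (hw : w ≠ 0) (s : Finset ι) (f : ι → ℤ) :
    w ^ (∑ i ∈ s, f i) = ∏ i ∈ s, w ^ f i := by
  classical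
  induction s using Finset.induction_on with
  | empty => simp
  | insert a s ha ih => rw [Finset.prod_insert ha, Finset.sum_insert ha, zpow_add₀ hw, ih]

/-! ### Interlacing and Schur functions -/

/-- The vectors `x ∈ W_{n+1}` and `y ∈ W_n` interlace: `x_1 < y_1 ≤ x_2 < y_2 ≤ … ≤ x_{n+1}`. -/
def Interlaced {n : ℕ} (x : W (n + 1)) (y : W n) : Prop :=
  ∀ j : Fin n, x.1 j.castSucc < y.1 j ∧ y.1 j ≤ x.1 j.succ

theorem interlaced_finite {n : ℕ} (x : W (n + 1)) : {y : W n | Interlaced x y}.Finite := by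
  have : (Set.Icc (fun j : Fin n => x.1 j.castSucc) (fun j => x.1 j.succ)).Finite :=
    Set.finite_Icc _ _
  refine (this.preimage (f := Subtype.val) Subtype.val_injective.injOn).subset ?_
  intro y hy
  exact ⟨fun j => (hy j).1.le, fun j => (hy j).2⟩

/-- The finite set of all `y` that interlace with `x`. -/
def lower {n : ℕ} (x : W (n + 1)) : Finset (W n) := (interlaced_finite x).toFinset

theorem mem_lower {n : ℕ} {x : W (n + 1)} {y : W n} : y ∈ lower x ↔ Interlaced x y := by
  simp [lower]

theorem lower_nonempty {n : ℕ} (x : W (n + 1)) : (lower x).Nonempty :=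
  ⟨⟨fun j => x.1 j.succ, fun _ _ h => x.2 (Fin.succ_lt_succ_iff.2 h)⟩,
    mem_lower.2 fun j => ⟨x.2 j.castSucc_lt_succ, le_rfl⟩⟩

/-- A sum over interlacing vectors of a product over coordinates factors: the coordinates range
independently over the intervals `(x_j, x_{j+1}]`. -/
theorem sum_lower_prod {n : ℕ} (x : W (n + 1)) (g : Fin n → ℤ → ℝ) :
    ∑ y ∈ lower x, ∏ j, g j (y.1 j) =
      ∏ j, ∑ m ∈ Finset.Ioc (x.1 j.castSucc) (x.1 j.succ), g j m := by
  rw [Finset.prod_univ_sum]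
  refine Finset.sum_bij (fun y _ => y.1) ?_ ?_ ?_ ?_
  · intro y hy
    simpa [Fintype.mem_piFinset, Interlaced] using mem_lower.1 hy
  · intro y _ y' _ h
    exact Subtype.ext h
  · intro y hy
    simp only [Fintype.mem_piFinset, Finset.mem_Ioc] at hy
    refine ⟨⟨y, fun i j hij => ?_⟩, mem_lower.2 hy, rfl⟩
    have : x.1 i.succ ≤ x.1 j.castSucc :=
      x.2.monotone (by rw [Fin.le_def]; simpa using hij)
    have h1 := (hy i).2
    have h2 := (hy j).1
    omega
  · intro y _
    rfl

theorem det_interval {n : ℕ} (x : W (n + 1)) (y : W n) (g : Fin n → Fin n → ℝ) :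
    Matrix.det (Matrix.of fun i j : Fin n =>
      if x.1 i.castSucc < y.1 j ∧ y.1 j ≤ x.1 i.succ then g i j else 0) =
    ∏ j : Fin n, if x.1 j.castSucc < y.1 j ∧ y.1 j ≤ x.1 j.succ then g j j else 0 := by
  apply det_eq_prod_diag_of_ordered
  intro i j hij k l hk hl
  simp only [Matrix.of_apply, ne_eq, ite_eq_right_iff, Classical.not_imp] at hk hl
  have hy := y.2 hij
  have : x.1 k.castSucc < x.1 l.succ := by omega
  have := x.2.lt_iff_lt.1 this
  rw [Fin.lt_def] at this
  rw [Fin.le_def]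
  simp at this
  omega

theorem prod_interval {n : ℕ} (x : W (n + 1)) (y : W n) (g : Fin n → ℝ)
    [Decidable (Interlaced x y)] :
    (∏ j : Fin n, if x.1 j.castSucc < y.1 j ∧ y.1 j ≤ x.1 j.succ then g j else 0) =
      if Interlaced x y then ∏ j, g j else 0 := by
  split_ifs with h
  · exact Finset.prod_congr rfl fun j _ => if_pos (h j)
  · unfold Interlaced at h
    push Not at h
    obtain ⟨j, hj⟩ := h
    refine Finset.prod_eq_zero (Finset.mem_univ j) (if_neg ?_)
    rintro ⟨h1, h2⟩
    have := hj h1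
    omega

open Classical in
theorem phiDet_eq {n : ℕ} (x : W (n + 1)) (y : W n) :
    phiDet x y = if Interlaced x y then 1 else 0 := by
  unfold phiDet
  rw [det_clear_last_col _ (fun _ => 1) (by simp [withVirt, phi])]
  have : (Matrix.of fun i j : Fin n =>
      (Matrix.of fun i j : Fin (n + 1) => phi (x.1 i) (withVirt y j)) i.succ j.castSucc -
      1 * (Matrix.of fun i j : Fin (n + 1) => phi (x.1 i) (withVirt y j)) i.castSucc j.castSucc)
      = -(Matrix.of fun i j : Fin n =>
      if x.1 i.castSucc < y.1 j ∧ y.1 j ≤ x.1 i.succ then (1 : ℝ) else 0) := by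
    ext i j
    have hx := x.2 i.castSucc_lt_succ
    simp only [withVirt, Matrix.of_apply, Matrix.neg_apply, Fin.snoc_castSucc, phi, one_mul]
    split_ifs <;> first | omega | norm_num
  rw [this, Matrix.det_neg, det_interval x y (fun _ _ => 1), prod_interval x y (fun _ => 1)]
  simp only [withVirt, phi, Matrix.of_apply, Fin.snoc_last, Fintype.card_fin, mul_one,
    ← mul_assoc, ← mul_pow]
  simp

open Classical in
theorem det_linkFun {n : ℕ} {w : ℝ} (hw : w ≠ 0) (x : W (n + 1)) (y : W n) :
    Matrix.det (Matrix.of fun i j : Fin (n + 1) => linkFun w (x.1 i) (withVirt y j)) =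
      (-1) ^ n * if Interlaced x y then w ^ (∑ i, x.1 i - ∑ i, y.1 i) else 0 := by
  rw [det_clear_last_col _ (fun i => w ^ (x.1 i.succ - x.1 i.castSucc))
    (by intro i; simp [withVirt, linkFun, ← zpow_add₀ hw])]
  have : (Matrix.of fun i j : Fin n =>
      (Matrix.of fun i j : Fin (n + 1) => linkFun w (x.1 i) (withVirt y j)) i.succ j.castSucc -
      w ^ (x.1 i.succ - x.1 i.castSucc) *
      (Matrix.of fun i j : Fin (n + 1) => linkFun w (x.1 i) (withVirt y j))
        i.castSucc j.castSucc)
      = (Matrix.of fun i j : Fin n =>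
      if x.1 i.castSucc < y.1 j ∧ y.1 j ≤ x.1 i.succ then w ^ (x.1 i.succ - y.1 j) else 0) := by
    ext i j
    have hx := x.2 i.castSucc_lt_succ
    simp only [withVirt, Matrix.of_apply, Fin.snoc_castSucc, linkFun, mul_ite, mul_zero,
      ← zpow_add₀ hw, sub_add_sub_cancel]
    split_ifs <;> first | omega | norm_num
  rw [this, det_interval x y (fun i j => w ^ (x.1 i.succ - y.1 j)),
    prod_interval x y (fun j => w ^ (x.1 j.succ - y.1 j))]
  simp only [withVirt, linkFun, Matrix.of_apply, Fin.snoc_last, mul_assoc, mul_ite, mul_zero]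
  congr 2
  rw [← zpow_sum₀ hw, ← zpow_add₀ hw, Finset.sum_sub_distrib, Fin.sum_univ_succ x.1, add_sub_assoc]

/-- The Schur function of the vector `x`, up to a monomial: the generating function of the
sequences of interlacing vectors below `x`. -/
def schur : ∀ {n : ℕ}, (Fin n → ℝ) → W n → ℝ
  | 0, _, _ => 1
  | n + 1, a, x => ∑ y ∈ lower x,
      a (Fin.last n) ^ (∑ i, x.1 i - ∑ i, y.1 i) * schur (fun i => a i.castSucc) y

/-- The alternating factor that is common to all `powDet a x`. -/
def alternant : ∀ {n : ℕ}, (Fin n → ℝ) → ℝ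
  | 0, _ => 1
  | n + 1, a => (-1) ^ n * (∏ j : Fin n, (1 - a (Fin.last n) / a j.castSucc)) *
      alternant (fun i => a i.castSucc)

/-- A geometric sum over the interval `(p, q]`. -/
theorem geom_interval {a w : ℝ} (ha : a ≠ 0) (hw : w ≠ 0) {p q : ℤ} (h : p ≤ q) :
    a ^ q - w ^ (q - p) * a ^ p = (1 - w / a) * ∑ k ∈ Finset.Ioc p q, a ^ k * w ^ (q - k) := by
  induction q, h using Int.leInduction with
  | base => simp
  | succ q hpq ih =>
    have : Finset.Ioc p (q + 1) = insert (q + 1) (Finset.Ioc p q) := by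
      ext k; simp only [Finset.mem_Ioc, Finset.mem_insert]; omega
    rw [this, Finset.sum_insert (by simp)]
    have h2 : ∑ k ∈ Finset.Ioc p q, a ^ k * w ^ (q + 1 - k) =
        w * ∑ k ∈ Finset.Ioc p q, a ^ k * w ^ (q - k) := by
      rw [Finset.mul_sum]
      refine Finset.sum_congr rfl fun k _ => ?_
      rw [show q + 1 - k = (q - k) + 1 by ring, zpow_add_one₀ hw]
      ring
    rw [h2, mul_add, mul_left_comm (1 - w / a) w, ← ih, sub_self, zpow_zero, zpow_add_one₀ ha,
      show q + 1 - p = (q - p) + 1 by ring, zpow_add_one₀ hw]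
    field_simp
    ring

/-- The branching rule: eliminating the last weight from the bialternant. -/
theorem powDet_succ {n : ℕ} {a : Fin (n + 1) → ℝ} (ha : ∀ i, a i ≠ 0) (x : W (n + 1)) :
    powDet a x = (-1) ^ n * (∏ j : Fin n, (1 - a (Fin.last n) / a j.castSucc)) *
      ∑ y ∈ lower x, a (Fin.last n) ^ (∑ i, x.1 i - ∑ i, y.1 i) *
        powDet (fun i => a i.castSucc) y := by
  set w := a (Fin.last n) with hw_def
  have hw : w ≠ 0 := ha _
  have hsum : ∑ y ∈ lower x, w ^ (∑ i, x.1 i - ∑ i, y.1 i) * powDet (fun i => a i.castSucc) y =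
      w ^ x.1 0 * Matrix.det (Matrix.of fun j i : Fin n =>
        ∑ k ∈ Finset.Ioc (x.1 j.castSucc) (x.1 j.succ),
          a i.castSucc ^ k * w ^ (x.1 j.succ - k)) := by
    rw [← Matrix.det_transpose, Matrix.det_apply', Finset.mul_sum]
    simp only [powDet, Matrix.det_apply', Finset.mul_sum]
    rw [Finset.sum_comm]
    refine Finset.sum_congr rfl fun σ _ => ?_
    simp only [Matrix.transpose_apply, Matrix.of_apply]
    rw [← sum_lower_prod x (fun j k => a (σ j).castSucc ^ k * w ^ (x.1 j.succ - k)),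
      mul_left_comm, Finset.mul_sum, Finset.mul_sum]
    refine Finset.sum_congr rfl fun y _ => ?_
    rw [Finset.prod_mul_distrib, ← zpow_sum₀ hw, Finset.sum_sub_distrib, Fin.sum_univ_succ x.1,
      add_sub_assoc, zpow_add₀ hw]
    ring
  rw [hsum, powDet, ← Matrix.det_transpose,
    det_clear_last_col _ (fun i => w ^ (x.1 i.succ - x.1 i.castSucc))
    (by intro i; simp [← hw_def, ← zpow_add₀ hw])]
  have : (Matrix.of fun i j : Fin n =>
      (Matrix.of fun i j : Fin (n + 1) => a i ^ x.1 j).transpose i.succ j.castSucc -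
      w ^ (x.1 i.succ - x.1 i.castSucc) *
      (Matrix.of fun i j : Fin (n + 1) => a i ^ x.1 j).transpose i.castSucc j.castSucc)
      = (Matrix.of fun j i : Fin n => (1 - w / a i.castSucc) *
        (Matrix.of fun j i : Fin n => ∑ k ∈ Finset.Ioc (x.1 j.castSucc) (x.1 j.succ),
          a i.castSucc ^ k * w ^ (x.1 j.succ - k)) j i) := by
    ext i j
    simp only [Matrix.transpose_apply, Matrix.of_apply]
    exact geom_interval (ha _) hw (x.2 i.castSucc_lt_succ).le
  rw [this, Matrix.det_mul_row]
  simp only [Matrix.transpose_apply, Matrix.of_apply]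
  ring

/-- The quotient of bialternants in the kernels is a quotient of Schur functions, which are
continuous and positive also where weights coincide. -/
theorem powDet_eq : ∀ {n : ℕ} {a : Fin n → ℝ} (_ : ∀ i, a i ≠ 0) (x : W n),
    powDet a x = alternant a * schur a x
  | 0, _, _, _ => by simp [powDet, alternant, schur]
  | n + 1, a, ha, x => by
    rw [powDet_succ ha, alternant, schur, mul_assoc _ (alternant _)]
    congr 1
    rw [Finset.mul_sum]
    refine Finset.sum_congr rfl fun y _ => ?_
    rw [powDet_eq (fun i => ha _) y]
    ring

theorem schur_pos : ∀ {n : ℕ} {a : Fin n → ℝ} (_ : ∀ i, 0 < a i) (x : W n), 0 < schur a x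
  | 0, _, _, _ => one_pos
  | n + 1, a, ha, x => by
    rw [schur]
    exact Finset.sum_pos (fun y _ => mul_pos (zpow_pos (ha _) _) (schur_pos (fun i => ha _) y))
      (lower_nonempty x)

theorem continuousAt_schur : ∀ {n : ℕ} {a : Fin n → ℝ} (_ : ∀ i, a i ≠ 0) (x : W n),
    ContinuousAt (fun a => schur a x) a
  | 0, _, _, _ => continuousAt_const
  | n + 1, a, ha, x => by
    simp only [schur]
    refine tendsto_finsetSum _ fun y _ => ?_
    refine ContinuousAt.mul ((continuousAt_apply _ _).zpow₀ _ (Or.inl (ha _))) ?_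
    exact ContinuousAt.comp (f := fun (a : Fin (n + 1) → ℝ) (i : Fin n) => a i.castSucc)
      (g := fun a => schur a y) (continuousAt_schur (fun i => ha _) y)
      (continuousAt_pi.2 fun i => continuousAt_apply _ _)

theorem alternant_ne_zero : ∀ {n : ℕ} {a : Fin n → ℝ} (_ : ∀ i, a i ≠ 0)
    (_ : Function.Injective a), alternant a ≠ 0
  | 0, _, _, _ => one_ne_zero
  | n + 1, a, ha, hinj => by
    rw [alternant]
    refine mul_ne_zero (mul_ne_zero (by simp) (Finset.prod_ne_zero_iff.2 fun j _ => ?_))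
      (alternant_ne_zero (fun i => ha _) (hinj.comp (Fin.castSucc_injective n)))
    rw [sub_ne_zero, ne_eq, eq_comm, div_eq_one_iff_eq (ha _)]
    exact fun h => (Fin.castSucc_lt_last j).ne (hinj h).symm

/-! ### The kernels in the limit of equal weights -/

/-- The weight of the move from `x` to `y`, in which each coordinate stays or goes up by one. By
`det_stepFun` it equals the determinant in `genP`. -/
def step (b : ℝ) {n : ℕ} (x y : W n) : ℝ := ∏ i, stepFun b (x.1 i - y.1 i)

open Classical in
/-- The weight `w ^ (|x| - |y|)` of a pair of interlacing vectors. -/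
def linkWeight (w : ℝ) {n : ℕ} (x : W (n + 1)) (y : W n) : ℝ :=
  if Interlaced x y then w ^ (∑ i, x.1 i - ∑ i, y.1 i) else 0

theorem genP_eq {n : ℕ} {a : Fin n → ℝ} (ha : ∀ i, a i ≠ 0) (hinj : Function.Injective a)
    (b : ℝ) (x y : W n) :
    genP a b x y = schur a y / schur a x * (step b x y / ∏ j, (1 + b * a j)) := by
  rw [genP, det_stepFun, powDet_eq ha, powDet_eq ha,
    mul_div_mul_left _ _ (alternant_ne_zero ha hinj), step]

theorem genLink_eq {n : ℕ} {a : Fin (n + 1) → ℝ} (ha : ∀ i, a i ≠ 0)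
    (hinj : Function.Injective a) (x : W (n + 1)) (y : W n) :
    genLink a x y = schur (fun i => a i.castSucc) y / schur a x *
      linkWeight (a (Fin.last n)) x y := by
  have h := alternant_ne_zero ha hinj
  rw [genLink, det_linkFun (ha _), powDet_eq ha, powDet_eq (fun i => ha _), linkWeight,
    Finset.prod_inv_distrib, div_inv_eq_mul]
  rw [alternant] at h ⊢
  obtain ⟨h1, h2⟩ := mul_ne_zero_iff.1 h
  obtain ⟨h3, h4⟩ := mul_ne_zero_iff.1 h1
  rw [mul_comm _ (alternant _), mul_assoc (alternant _), mul_div_mul_left _ _ h2]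
  field_simp

theorem towerWeights_pos {α α' : ℝ} (hα : 0 < α) (hα' : 0 < α') {n : ℕ} (i : Fin n) :
    0 < towerWeights α α' n i := by
  unfold towerWeights; split_ifs <;> assumption

/-- Every vector is a limit of vectors with pairwise different entries: `a_i + ε i`, `ε → 0`. -/
instance towerLimit_neBot (α α' : ℝ) (n : ℕ) : (towerLimit α α' n).NeBot := by
  set a := towerWeights α α' n
  have ht : Tendsto (fun (ε : ℝ) (i : Fin n) => a i + ε * (i : ℕ)) (𝓝[≠] 0)
      (𝓝[{a | Function.Injective a}] a) := by
    refine tendsto_nhdsWithin_iff.2 ⟨?_, ?_⟩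
    · refine tendsto_nhdsWithin_of_tendsto_nhds ?_
      have : Continuous fun (ε : ℝ) (i : Fin n) => a i + ε * (i : ℕ) := by fun_prop
      simpa using this.tendsto 0
    · have : ∀ i j : Fin n, i ≠ j → ∀ᶠ ε : ℝ in 𝓝[≠] 0,
          a i + ε * (i : ℕ) ≠ a j + ε * (j : ℕ) := by
        intro i j hij
        by_cases h : a i = a j
        · filter_upwards [self_mem_nhdsWithin] with ε hε
          rw [h]
          intro heq
          have := mul_left_cancel₀ hε (add_left_cancel heq)
          exact hij (Fin.ext (by exact_mod_cast this))
        · refine nhdsWithin_le_nhds ?_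
          have hc : Continuous fun ε : ℝ => a i + ε * (i : ℕ) - (a j + ε * (j : ℕ)) := by
            fun_prop
          have := hc.continuousAt.eventually_ne (x := (0 : ℝ)) (y := 0)
            (by simpa [sub_eq_zero] using h)
          filter_upwards [this] with ε hε
          exact sub_ne_zero.1 hε
      have := (eventually_all.2 fun i => eventually_all.2 fun j =>
        eventually_imp_distrib_left.2 (this i j))
      filter_upwards [this] with ε hε i j hij
      by_contra h
      exact hε i j h hij
  exact ht.neBot

theorem eventually_towerLimit {α α' : ℝ} (hα : 0 < α) (hα' : 0 < α') (n : ℕ) :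
    ∀ᶠ a in towerLimit α α' n, (∀ i, a i ≠ 0) ∧ Function.Injective a := by
  refine Eventually.and ?_ self_mem_nhdsWithin
  refine nhdsWithin_le_nhds (eventually_all.2 fun i => ?_)
  exact (continuousAt_apply i _).eventually_ne (towerWeights_pos hα hα' i).ne'

theorem tendsto_schur {α α' : ℝ} (hα : 0 < α) (hα' : 0 < α') {n : ℕ} (x : W n) :
    Tendsto (fun a => schur a x) (towerLimit α α' n) (𝓝 (schur (towerWeights α α' n) x)) :=
  tendsto_nhdsWithin_of_tendsto_nhds
    (continuousAt_schur (fun i => (towerWeights_pos hα hα' i).ne') x)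

theorem tendsto_genP {α α' : ℝ} (hα : 0 < α) (hα' : 0 < α') {n : ℕ} {b : ℝ} (hb : 0 ≤ b)
    (x y : W n) :
    Tendsto (fun a => genP a b x y) (towerLimit α α' n)
      (𝓝 (schur (towerWeights α α' n) y / schur (towerWeights α α' n) x *
        (step b x y / ∏ j, (1 + b * towerWeights α α' n j)))) := by
  have hpos : ∏ j, (1 + b * towerWeights α α' n j) ≠ 0 :=
    (Finset.prod_pos fun j _ => by have := towerWeights_pos hα hα' j; positivity).ne'
  have hprod : Tendsto (fun a : Fin n → ℝ => ∏ j, (1 + b * a j)) (towerLimit α α' n)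
      (𝓝 (∏ j, (1 + b * towerWeights α α' n j))) := by
    have : Continuous fun a : Fin n → ℝ => ∏ j, (1 + b * a j) := by fun_prop
    exact tendsto_nhdsWithin_of_tendsto_nhds (this.tendsto _)
  refine Tendsto.congr' ?_ (((tendsto_schur hα hα' y).div (tendsto_schur hα hα' x)
    (schur_pos (towerWeights_pos hα hα') x).ne').mul (tendsto_const_nhds.div hprod hpos))
  filter_upwards [eventually_towerLimit hα hα' n] with a ha
  exact (genP_eq ha.1 ha.2 b x y).symm

theorem towerP_eq {α α' : ℝ} (hα : 0 < α) (hα' : 0 < α') {n : ℕ} {b : ℝ} (hb : 0 ≤ b)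
    (x y : W n) :
    towerP α α' b x y = schur (towerWeights α α' n) y / schur (towerWeights α α' n) x *
        (step b x y / ∏ j, (1 + b * towerWeights α α' n j)) :=
  (tendsto_genP hα hα' hb x y).limUnder_eq

theorem tendsto_genLink {α α' : ℝ} (hα : 0 < α) (hα' : 0 < α') {n : ℕ}
    (x : W (n + 1)) (y : W n) :
    Tendsto (fun a => genLink a x y) (towerLimit α α' (n + 1))
      (𝓝 (schur (towerWeights α α' n) y / schur (towerWeights α α' (n + 1)) x *
        linkWeight (towerWeights α α' (n + 1) (Fin.last n)) x y)) := by
  have h1 : Tendsto (fun a : Fin (n + 1) → ℝ => schur (fun i => a i.castSucc) y)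
      (towerLimit α α' (n + 1)) (𝓝 (schur (towerWeights α α' n) y)) := by
    refine tendsto_nhdsWithin_of_tendsto_nhds ?_
    exact ContinuousAt.comp (f := fun (a : Fin (n + 1) → ℝ) (i : Fin n) => a i.castSucc)
      (g := fun a => schur a y)
      (continuousAt_schur (fun i => (towerWeights_pos hα hα' (Fin.castSucc i)).ne') y)
      (continuousAt_pi.2 fun i => continuousAt_apply _ _)
  have h2 : Tendsto (fun a : Fin (n + 1) → ℝ => linkWeight (a (Fin.last n)) x y)
      (towerLimit α α' (n + 1))
      (𝓝 (linkWeight (towerWeights α α' (n + 1) (Fin.last n)) x y)) := by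
    refine tendsto_nhdsWithin_of_tendsto_nhds ?_
    unfold linkWeight
    split_ifs
    · exact (continuousAt_apply _ _).zpow₀ _ (Or.inl (towerWeights_pos hα hα' _).ne')
    · exact tendsto_const_nhds
  refine Tendsto.congr' ?_ ((h1.div (tendsto_schur hα hα' x)
    (schur_pos (towerWeights_pos hα hα') x).ne').mul h2)
  filter_upwards [eventually_towerLimit hα hα' _] with a ha
  exact (genLink_eq ha.1 ha.2 x y).symm

theorem towerLink_eq {α α' : ℝ} (hα : 0 < α) (hα' : 0 < α') {n : ℕ}
    (x : W (n + 1)) (y : W n) :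
    towerLink α α' x y =
      schur (towerWeights α α' n) y / schur (towerWeights α α' (n + 1)) x *
        linkWeight (towerWeights α α' (n + 1) (Fin.last n)) x y :=
  (tendsto_genLink hα hα' x y).limUnder_eq

/-! ### Sums of products -/

theorem support_pi_prod_finite {ι : Type*} [Fintype ι] {κ : ι → Type*} (f : ∀ i, κ i → ℝ)
    (hf : ∀ i, (Function.support (f i)).Finite) :
    (Function.support fun c : ∀ i, κ i => ∏ i, f i (c i)).Finite := by
  refine (Set.Finite.pi hf).subset fun c hc i _ => ?_
  exact Finset.prod_ne_zero_iff.1 hc i (Finset.mem_univ i)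

theorem hasSum_pi_prod {ι : Type*} [Fintype ι] {κ : ι → Type*} (f : ∀ i, κ i → ℝ)
    (hf : ∀ i, (Function.support (f i)).Finite) :
    HasSum (fun c : ∀ i, κ i => ∏ i, f i (c i)) (∏ i, ∑' l, f i l) := by
  classical
  have h : ∀ i, ∑' l, f i l = ∑ l ∈ (hf i).toFinset, f i l := fun i =>
    tsum_eq_sum fun l hl => by simpa using hl
  simp only [h, Finset.prod_univ_sum]
  refine hasSum_sum_of_ne_finset_zero fun c hc => ?_
  rw [Fintype.mem_piFinset] at hc
  push Not at hc
  obtain ⟨i, hi⟩ := hc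
  exact Finset.prod_eq_zero (Finset.mem_univ i) (by simpa using hi)

theorem tsum_W_prod {n : ℕ} (g : Fin n → ℤ → ℝ) (hg : ∀ i, (Function.support (g i)).Finite)
    (hmono : ∀ v : Fin n → ℤ, (∀ i, g i (v i) ≠ 0) → StrictMono v) :
    ∑' v : W n, ∏ i, g i (v.1 i) = ∏ i, ∑' m, g i m := by
  rw [← (hasSum_pi_prod g hg).tsum_eq]
  exact tsum_subtype_eq_of_support_subset (s := {v : Fin n → ℤ | StrictMono v})
    (f := fun v => ∏ i, g i (v i)) fun v hv =>
      hmono v fun i => Finset.prod_ne_zero_iff.1 hv i (Finset.mem_univ i)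

theorem tsum_stepFun_sub_left (b : ℝ) (p : ℤ) (h : ℤ → ℝ) :
    ∑' m, stepFun b (p - m) * h m = h p + b * h (p + 1) := by
  rw [tsum_eq_sum (s := {p, p + 1}), Finset.sum_pair (by omega)]
  · simp [stepFun_zero, stepFun_neg_one]
  · intro m hm
    simp only [Finset.mem_insert, Finset.mem_singleton, not_or] at hm
    rw [stepFun_eq_zero (by omega) (by omega), zero_mul]

theorem tsum_stepFun_sub_right (b : ℝ) (p : ℤ) (h : ℤ → ℝ) :
    ∑' m, stepFun b (m - p) * h m = h p + b * h (p - 1) := by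
  rw [tsum_eq_sum (s := {p, p - 1}), Finset.sum_pair (by omega)]
  · simp [stepFun_zero, stepFun_neg_one]
  · intro m hm
    simp only [Finset.mem_insert, Finset.mem_singleton, not_or] at hm
    rw [stepFun_eq_zero (by omega) (by omega), zero_mul]

/-! ### The kernels commute -/

/-- The weights of the steps commute with those of the links. Both sums factor over coordinates;
with `q = b w` and `0/1`-valued `L, L', R, R'` that compare neighbouring coordinates of `u` and `v`
(`L', R'` after a step), each factor `X = R L + q R' L'` satisfies
`(1 + q) X = (R + q R') (L + q L')`, because `L ≠ L'` and `R ≠ R'` cannot hold together. -/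
theorem step_link_comm {b w : ℝ} (hb : 0 ≤ b) (hw : 0 < w) {n : ℕ} (u : W (n + 1)) (v : W n) :
    ∑' s : W (n + 1), step b u s * linkWeight w s v =
      (1 + b * w) * ∑' s : W n, linkWeight w u s * step b s v := by
  classical
  set q := b * w with hq
  have hq1 : (1 + q) ≠ 0 := by positivity
  -- the comparisons of the coordinates, after a step `e` of `u`
  let l (e : ℤ) (i : Fin n) : ℝ := if u.1 i.castSucc + e < v.1 i then 1 else 0
  let r (e : ℤ) (i : Fin n) : ℝ := if v.1 i ≤ u.1 i.succ + e then 1 else 0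
  let lo (i : Fin (n + 1)) (m : ℤ) : Prop := ∀ j : Fin n, j.succ = i → v.1 j ≤ m
  let hi (i : Fin (n + 1)) (m : ℤ) : Prop := ∀ j : Fin n, j.castSucc = i → m < v.1 j
  have hleft : ∑' s : W n, linkWeight w u s * step b s v =
      w ^ (∑ i, u.1 i - ∑ i, v.1 i) * ∏ i, (l 0 i * r 0 i + q * (l 1 i * r 1 i)) := by
    have h1 : ∀ s : W n, linkWeight w u s * step b s v = w ^ (∑ i, u.1 i - ∑ i, v.1 i) *
        ∏ i, (stepFun b (s.1 i - v.1 i) * (w ^ (v.1 i - s.1 i) *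
          if u.1 i.castSucc < s.1 i ∧ s.1 i ≤ u.1 i.succ then 1 else 0)) := by
      intro s
      rw [Finset.prod_mul_distrib, Finset.prod_mul_distrib, prod_interval u s (fun _ => 1),
        ← zpow_sum₀ hw.ne', Finset.sum_sub_distrib, linkWeight, step]
      split_ifs with h
      · rw [Finset.prod_const_one, mul_one, mul_left_comm, ← zpow_add₀ hw.ne',
          sub_add_sub_cancel, mul_comm]
      · ring
    simp only [h1]
    rw [tsum_mul_left, tsum_W_prod (fun i m => stepFun b (m - v.1 i) * (w ^ (v.1 i - m) *
          if u.1 i.castSucc < m ∧ m ≤ u.1 i.succ then 1 else 0))]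
    · congr 1
      refine Finset.prod_congr rfl fun i _ => ?_
      rw [tsum_stepFun_sub_right]
      have e1 : (u.1 i.castSucc < v.1 i - 1) ↔ (u.1 i.castSucc + 1 < v.1 i) := by omega
      have e2 : (v.1 i - 1 ≤ u.1 i.succ) ↔ (v.1 i ≤ u.1 i.succ + 1) := by omega
      simp only [sub_self, zpow_zero, one_mul, sub_sub_cancel, zpow_one, e1, e2, l, r, add_zero,
        ite_and, hq]
      split_ifs <;> ring
    · intro i
      refine (Set.finite_Icc (v.1 i - 1) (v.1 i)).subset fun m hm => ?_
      have := stepFun_support (left_ne_zero_of_mul hm)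
      simp only [Set.mem_Icc]; omega
    · intro s hs i j hij
      have h2 : ∀ i, u.1 i.castSucc < s i ∧ s i ≤ u.1 i.succ := fun i => by
        by_contra hcon
        exact hs i (by rw [if_neg hcon, mul_zero, mul_zero])
      have : u.1 i.succ ≤ u.1 j.castSucc :=
        u.2.monotone (by rw [Fin.le_def]; simpa using hij)
      have := h2 i
      have := h2 j
      omega
  have hright : ∑' s : W (n + 1), step b u s * linkWeight w s v =
      w ^ (∑ i, u.1 i - ∑ i, v.1 i) * ∏ i : Fin (n + 1),
        ((if lo i (u.1 i) then 1 else 0) * (if hi i (u.1 i) then 1 else 0) +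
          q * ((if lo i (u.1 i + 1) then 1 else 0) * (if hi i (u.1 i + 1) then 1 else 0))) := by
    have hint : ∀ s : Fin (n + 1) → ℤ, (∀ i, lo i (s i) ∧ hi i (s i)) ↔
        ∀ j : Fin n, s j.castSucc < v.1 j ∧ v.1 j ≤ s j.succ := by
      intro s
      constructor
      · exact fun h j => ⟨(h _).2 j rfl, (h _).1 j rfl⟩
      · exact fun h i => ⟨fun j hj => hj ▸ (h j).2, fun j hj => hj ▸ (h j).1⟩
    have h1 : ∀ s : W (n + 1), step b u s * linkWeight w s v = w ^ (∑ i, u.1 i - ∑ i, v.1 i) *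
        ∏ i, (stepFun b (u.1 i - s.1 i) * (w ^ (s.1 i - u.1 i) *
          if lo i (s.1 i) ∧ hi i (s.1 i) then 1 else 0)) := by
      intro s
      rw [Finset.prod_mul_distrib, Finset.prod_mul_distrib,
        ← zpow_sum₀ hw.ne', Finset.sum_sub_distrib, linkWeight, step]
      by_cases h : Interlaced s v
      · rw [if_pos h, Finset.prod_eq_one
          (f := fun i => if lo i (s.1 i) ∧ hi i (s.1 i) then _ else _)
          fun i _ => if_pos ((hint s.1).2 h i), mul_one, mul_left_comm, ← zpow_add₀ hw.ne',
          sub_add_sub_cancel']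
      · rw [if_neg h]
        have : ¬ ∀ i, lo i (s.1 i) ∧ hi i (s.1 i) := fun hcon => h ((hint s.1).1 hcon)
        push Not at this
        obtain ⟨i, hni⟩ := this
        rw [Finset.prod_eq_zero (f := fun i => if lo i (s.1 i) ∧ hi i (s.1 i) then _ else _)
          (Finset.mem_univ i) (if_neg fun hcon => hni hcon.1 hcon.2)]
        ring
    simp only [h1]
    rw [tsum_mul_left, tsum_W_prod (fun i m => stepFun b (u.1 i - m) * (w ^ (m - u.1 i) *
          if lo i m ∧ hi i m then 1 else 0))]
    · congr 1
      refine Finset.prod_congr rfl fun i _ => ?_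
      rw [tsum_stepFun_sub_left]
      simp only [sub_self, zpow_zero, one_mul, add_sub_cancel_left, zpow_one,
        ite_and, hq]
      split_ifs <;> ring
    · intro i
      refine (Set.finite_Icc (u.1 i) (u.1 i + 1)).subset fun m hm => ?_
      have := stepFun_support (left_ne_zero_of_mul hm)
      simp only [Set.mem_Icc]; omega
    · intro s hs
      have h2 := (hint s).1 fun i => by
        by_contra hcon
        exact hs i (by rw [if_neg hcon, mul_zero, mul_zero])
      exact Fin.strictMono_iff_lt_succ.2 fun i => lt_of_lt_of_le (h2 i).1 (h2 i).2
  let Rt : Fin (n + 1) → ℝ := Fin.cons (1 + q) fun i => r 0 i + q * r 1 i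
  let Lt : Fin (n + 1) → ℝ := Fin.snoc (fun i => l 0 i + q * l 1 i) (1 + q)
  have hA : ∀ i : Fin n, (1 + q) * (l 0 i * r 0 i + q * (l 1 i * r 1 i)) =
      (r 0 i + q * r 1 i) * (l 0 i + q * l 1 i) := by
    intro i
    have := u.2 i.castSucc_lt_succ
    simp only [l, r]
    split_ifs <;> first | omega | ring
  have hlo0 : ∀ m, lo 0 m := fun m j hj => absurd hj (Fin.succ_ne_zero j)
  have hlo : ∀ j m, lo (Fin.succ j) m ↔ v.1 j ≤ m := fun j m =>
    ⟨fun h => h j rfl, fun h k hk => Fin.succ_injective _ hk ▸ h⟩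
  have hhil : ∀ m, hi (Fin.last n) m := fun m j hj => absurd hj (Fin.castSucc_lt_last j).ne
  have hhi : ∀ j m, hi (Fin.castSucc j) m ↔ m < v.1 j := fun j m =>
    ⟨fun h => h j rfl, fun h k hk => Fin.castSucc_injective _ hk ▸ h⟩
  have hB : ∀ i : Fin (n + 1), (1 + q) *
      ((if lo i (u.1 i) then 1 else 0) * (if hi i (u.1 i) then 1 else 0) +
          q * ((if lo i (u.1 i + 1) then 1 else 0) * (if hi i (u.1 i + 1) then 1 else 0))) =
      Rt i * Lt i := by
    intro i
    have hR : Rt i = (if lo i (u.1 i) then 1 else 0) + q * (if lo i (u.1 i + 1) then 1 else 0) := by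
      refine Fin.cases ?_ (fun j => ?_) i
      · simp [Rt, hlo0]
      · simp [Rt, hlo, r]
    have hL : Lt i = (if hi i (u.1 i) then 1 else 0) + q * (if hi i (u.1 i + 1) then 1 else 0) := by
      refine Fin.lastCases ?_ (fun j => ?_) i
      · simp [Lt, hhil]
      · simp [Lt, hhi, l]
    rw [hR, hL]
    -- the two comparisons of `u i` change at different steps since `v` is strictly increasing
    have hlomono : lo i (u.1 i) → lo i (u.1 i + 1) := fun h j hj => (h j hj).trans (by omega)
    have hhimono : hi i (u.1 i + 1) → hi i (u.1 i) := fun h j hj => by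
      have := h j hj; omega
    have hexcl : lo i (u.1 i + 1) → hi i (u.1 i) → lo i (u.1 i) ∨ hi i (u.1 i + 1) := by
      intro h1 h2
      by_contra hcon
      simp only [lo, hi, not_or, not_forall] at hcon
      obtain ⟨⟨j, hj, hj'⟩, k, hk, hk'⟩ := hcon
      have h3 := h1 j hj
      have h4 := h2 k hk
      have hjk : j < k := by
        rw [Fin.lt_def]
        have := congrArg Fin.val (hj.trans hk.symm)
        simp at this
        omega
      have := v.2 hjk
      omega
    by_cases c1 : lo i (u.1 i) <;> by_cases c2 : lo i (u.1 i + 1) <;>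
      by_cases c3 : hi i (u.1 i) <;> by_cases c4 : hi i (u.1 i + 1) <;>
      simp only [c1, c2, c3, c4, if_true, if_false] <;> first | (exfalso; tauto) | ring
  have hprodA := Finset.prod_congr rfl fun i (_ : i ∈ Finset.univ) => hA i
  have hprodB := Finset.prod_congr rfl fun i (_ : i ∈ Finset.univ) => hB i
  rw [Finset.prod_mul_distrib, Finset.prod_mul_distrib] at hprodA hprodB
  simp only [Finset.prod_const, Finset.card_univ, Fintype.card_fin] at hprodA hprodB
  have hRt : ∏ i, Rt i = (1 + q) * ∏ i, (r 0 i + q * r 1 i) := by simp [Rt, Fin.prod_univ_succ]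
  have hLt : ∏ i, Lt i = (∏ i, (l 0 i + q * l 1 i)) * (1 + q) := by
    simp [Lt, Fin.prod_univ_castSucc]
  rw [hRt, hLt] at hprodB
  rw [hleft, hright, mul_left_comm]
  congr 1
  apply mul_left_cancel₀ (pow_ne_zero (n + 1) hq1)
  rw [hprodB, pow_succ]
  linear_combination -(1 + q) ^ 2 * hprodA

section Kernels

variable {α α' : ℝ}

theorem step_nonneg {b : ℝ} (hb : 0 ≤ b) {n : ℕ} (x y : W n) : 0 ≤ step b x y :=
  Finset.prod_nonneg fun _ _ => stepFun_nonneg hb _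

theorem linkWeight_nonneg {w : ℝ} (hw : 0 < w) {n : ℕ} (x : W (n + 1)) (y : W n) :
    0 ≤ linkWeight w x y := by
  unfold linkWeight; positivity

theorem towerP_nonneg (hα : 0 < α) (hα' : 0 < α') {n : ℕ} {b : ℝ} (hb : 0 ≤ b) (x y : W n) :
    0 ≤ towerP α α' b x y := by
  have ha := fun i => towerWeights_pos hα hα' (n := n) i
  rw [towerP_eq hα hα' hb]
  refine mul_nonneg (div_pos (schur_pos ha y) (schur_pos ha x)).le
    (div_nonneg (step_nonneg hb x y) (Finset.prod_nonneg fun j _ => ?_))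
  have := ha j
  positivity

theorem towerLink_nonneg (hα : 0 < α) (hα' : 0 < α') {n : ℕ} (x : W (n + 1)) (y : W n) :
    0 ≤ towerLink α α' x y := by
  rw [towerLink_eq hα hα']
  exact mul_nonneg (div_pos (schur_pos (towerWeights_pos hα hα') y)
    (schur_pos (towerWeights_pos hα hα') x)).le (linkWeight_nonneg (towerWeights_pos hα hα' _) x y)

theorem towerP_support_finite (hα : 0 < α) (hα' : 0 < α') {n : ℕ} {b : ℝ} (hb : 0 ≤ b)
    (x : W n) : (Function.support (towerP α α' b x)).Finite := by
  have : (Set.Icc x.1 (fun j => x.1 j + 1)).Finite := Set.finite_Icc _ _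
  refine (this.preimage (f := Subtype.val) Subtype.val_injective.injOn).subset ?_
  intro y hy
  rw [Function.mem_support, towerP_eq hα hα' hb] at hy
  have h := Finset.prod_ne_zero_iff.1 (div_ne_zero_iff.1 (right_ne_zero_of_mul hy)).1
  have h2 := fun i => stepFun_support (h i (Finset.mem_univ i))
  constructor <;> intro i <;> have := h2 i <;> simp only <;> omega

theorem towerLink_support_finite (hα : 0 < α) (hα' : 0 < α') {n : ℕ} (x : W (n + 1)) :
    (Function.support (towerLink α α' x)).Finite := by
  refine (interlaced_finite x).subset fun y hy => ?_
  rw [Function.mem_support, towerLink_eq hα hα'] at hy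
  by_contra h
  exact right_ne_zero_of_mul hy (if_neg h)

/-- The kernels commute with the links. -/
theorem towerP_towerLink_comm (hα : 0 < α) (hα' : 0 < α') {n : ℕ} {b : ℝ} (hb : 0 ≤ b)
    (u : W (n + 1)) (w : W n) :
    ∑' v, towerP α α' b u v * towerLink α α' v w =
      ∑' v, towerLink α α' u v * towerP α α' b v w := by
  have hpos := fun m => towerWeights_pos hα hα' (n := m)
  have hs := fun m x => (schur_pos (hpos m) x).ne'
  have hprod : ∏ j, (1 + b * towerWeights α α' (n + 1) j) =
      (∏ j, (1 + b * towerWeights α α' n j)) *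
        (1 + b * towerWeights α α' (n + 1) (Fin.last n)) := Fin.prod_univ_castSucc _
  have h1 : ∀ j, 1 + b * towerWeights α α' n j ≠ 0 := fun j => by
    have := hpos n j; positivity
  have h2 : 1 + b * towerWeights α α' (n + 1) (Fin.last n) ≠ 0 := by
    have := hpos _ (Fin.last n); positivity
  have h3 := Finset.prod_ne_zero_iff.2 fun j (_ : j ∈ Finset.univ) => h1 j
  simp only [towerP_eq hα hα' hb, towerLink_eq hα hα']
  have e1 : ∀ v : W (n + 1), schur (towerWeights α α' (n + 1)) v /
      schur (towerWeights α α' (n + 1)) u *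
        (step b u v / ∏ j, (1 + b * towerWeights α α' (n + 1) j)) *
      (schur (towerWeights α α' n) w / schur (towerWeights α α' (n + 1)) v *
        linkWeight (towerWeights α α' (n + 1) (Fin.last n)) v w) =
      schur (towerWeights α α' n) w / schur (towerWeights α α' (n + 1)) u /
        (∏ j, (1 + b * towerWeights α α' (n + 1) j)) *
        (step b u v * linkWeight (towerWeights α α' (n + 1) (Fin.last n)) v w) := by
    intro v
    have := hs _ v
    field_simp
  have e2 : ∀ v : W n, schur (towerWeights α α' n) v / schur (towerWeights α α' (n + 1)) u *
        linkWeight (towerWeights α α' (n + 1) (Fin.last n)) u v *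
      (schur (towerWeights α α' n) w / schur (towerWeights α α' n) v *
        (step b v w / ∏ j, (1 + b * towerWeights α α' n j))) =
      schur (towerWeights α α' n) w / schur (towerWeights α α' (n + 1)) u /
        (∏ j, (1 + b * towerWeights α α' n j)) *
        (linkWeight (towerWeights α α' (n + 1) (Fin.last n)) u v * step b v w) := by
    intro v
    have := hs _ v
    field_simp
  simp only [e1, e2]
  rw [tsum_mul_left, tsum_mul_left, step_link_comm hb (hpos _ _), hprod]
  have := hs _ u
  field_simp

theorem tsum_towerLink (hα : 0 < α) (hα' : 0 < α') {n : ℕ} (x : W (n + 1)) :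
    ∑' y : W n, towerLink α α' x y = 1 := by
  rw [tsum_eq_sum (s := lower x)]
  · have hx := (schur_pos (towerWeights_pos hα hα') x).ne'
    rw [← div_self hx]
    nth_rw 1 [schur]
    rw [Finset.sum_div]
    refine Finset.sum_congr rfl fun y hy => ?_
    rw [towerLink_eq hα hα', linkWeight, if_pos (mem_lower.1 hy)]
    change _ = _ * schur (towerWeights α α' n) y / _
    ring
  · intro y hy
    rw [towerLink_eq hα hα', linkWeight, if_neg fun h => hy (mem_lower.2 h), mul_zero]

instance : Unique (W 0) where
  default := packed 0
  uniq _ := Subtype.ext (Subsingleton.elim _ _)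

theorem towerP_empty (hα : 0 < α) (hα' : 0 < α') {b : ℝ} (hb : 0 ≤ b) (x y : W 0) :
    towerP α α' b x y = 1 := by
  rw [towerP_eq hα hα' hb]
  simp [schur, step]

theorem tsum_comm_of_finite_support {X Y : Type*} {f : X → ℝ} {g : X → Y → ℝ}
    (hf : (Function.support f).Finite) (hg : ∀ x, (Function.support (g x)).Finite) :
    ∑' x, f x * ∑' y, g x y = ∑' y, ∑' x, f x * g x y := by
  have h1 : ∀ h : X → ℝ, ∑' x, f x * h x = ∑ x ∈ hf.toFinset, f x * h x := fun h =>
    tsum_eq_sum fun x hx => by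
      have : f x = 0 := by simpa using hx
      rw [this, zero_mul]
  simp only [h1]
  rw [Summable.tsum_finsetSum fun x _ => (summable_of_hasFiniteSupport (hg x)).mul_left (f x)]
  exact Finset.sum_congr rfl fun x _ => tsum_mul_left.symm

/-- The rows of the kernels sum to one: by commutation, the mass of a row is an average of masses
of rows of the kernel in one dimension less. -/
theorem tsum_towerP (hα : 0 < α) (hα' : 0 < α') {b : ℝ} (hb : 0 ≤ b) :
    ∀ {n : ℕ} (x : W n), ∑' y, towerP α α' b x y = 1
  | 0, x => by simp [tsum_fintype, towerP_empty hα hα' hb]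
  | n + 1, x => by
    calc ∑' y, towerP α α' b x y
        = ∑' y, towerP α α' b x y * ∑' w, towerLink α α' y w := by
          simp [tsum_towerLink hα hα']
      _ = ∑' w, ∑' y, towerP α α' b x y * towerLink α α' y w :=
          tsum_comm_of_finite_support (towerP_support_finite hα hα' hb x)
            (towerLink_support_finite hα hα')
      _ = ∑' w, ∑' v, towerLink α α' x v * towerP α α' b v w := by
          simp only [towerP_towerLink_comm hα hα' hb]
      _ = ∑' v, towerLink α α' x v * ∑' w, towerP α α' b v w :=
          (tsum_comm_of_finite_support (towerLink_support_finite hα hα' x)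
            (towerP_support_finite hα hα' hb)).symm
      _ = 1 := by simp [tsum_towerP hα hα' hb, tsum_towerLink hα hα']

open Classical in
theorem towerP_zero (hα : 0 < α) (hα' : 0 < α') {n : ℕ} (x y : W n) :
    towerP α α' 0 x y = if x = y then 1 else 0 := by
  rw [towerP_eq hα hα' le_rfl]
  split_ifs with h
  · subst h
    simp [step, stepFun_zero, (schur_pos (towerWeights_pos hα hα') x).ne']
  · have : ∃ i, x.1 i ≠ y.1 i := by
      by_contra hcon
      push Not at hcon
      exact h (Subtype.ext (funext hcon))
    obtain ⟨i, hi⟩ := this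
    have : step 0 x y = 0 :=
      Finset.prod_eq_zero (Finset.mem_univ i) (by simp [stepFun, sub_eq_zero, hi])
    simp [this]

theorem interlaced_packed {n : ℕ} {y : W n} (h : Interlaced (packed (n + 1)) y) :
    y = packed n := by
  refine Subtype.ext (funext fun j => ?_)
  have := h j
  simp [packed] at this ⊢
  omega

open Classical in
theorem towerLink_packed (hα : 0 < α) (hα' : 0 < α') {n : ℕ} (y : W n) :
    towerLink α α' (packed (n + 1)) y = if y = packed n then 1 else 0 := by
  have h0 : ∀ y : W n, y ≠ packed n → towerLink α α' (packed (n + 1)) y = 0 := fun y hy => by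
    rw [towerLink_eq hα hα', linkWeight, if_neg fun h => hy (interlaced_packed h), mul_zero]
  split_ifs with h
  · rw [h]
    have : ∑' y : W n, towerLink α α' (packed (n + 1)) y = _ := tsum_eq_single (packed n) h0
    rw [tsum_towerLink hα hα'] at this
    exact this.symm
  · exact h0 y h

end Kernels

/-! ### Middle points -/

section Middle

variable {α α' : ℝ}

/-- The two-step kernel `P ∘ Λ`, which normalizes `middle`. -/
def twoStep (α α' b : ℝ) {n : ℕ} (u : W (n + 1)) (w : W n) : ℝ :=
  ∑' v, towerP α α' b u v * towerLink α α' v w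

theorem summable_twoStep (hα : 0 < α) (hα' : 0 < α') {b : ℝ} (hb : 0 ≤ b) {n : ℕ}
    (u : W (n + 1)) (w : W n) :
    Summable fun v => towerP α α' b u v * towerLink α α' v w :=
  summable_of_hasFiniteSupport
    ((towerP_support_finite hα hα' hb u).subset fun _ hv => left_ne_zero_of_mul hv)

theorem twoStep_nonneg (hα : 0 < α) (hα' : 0 < α') {b : ℝ} (hb : 0 ≤ b) {n : ℕ}
    (u : W (n + 1)) (w : W n) : 0 ≤ twoStep α α' b u w :=
  tsum_nonneg fun v => mul_nonneg (towerP_nonneg hα hα' hb u v) (towerLink_nonneg hα hα' v w)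

theorem twoStep_eq_swap (hα : 0 < α) (hα' : 0 < α') {b : ℝ} (hb : 0 ≤ b) {n : ℕ}
    (u : W (n + 1)) (w : W n) :
    twoStep α α' b u w = ∑' v, towerLink α α' u v * towerP α α' b v w :=
  towerP_towerLink_comm hα hα' hb u w

theorem middle_nonneg (hα : 0 < α) (hα' : 0 < α') {b : ℝ} (hb : 0 ≤ b) {n : ℕ}
    (u : W (n + 1)) (w : W n) (v : W (n + 1)) : 0 ≤ middle α α' b u w v :=
  div_nonneg (mul_nonneg (towerP_nonneg hα hα' hb u v) (towerLink_nonneg hα hα' v w))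
    (twoStep_nonneg hα hα' hb u w)

theorem towerP_ne_zero_of_middle {b : ℝ} {n : ℕ} {u : W (n + 1)} {w : W n} {v : W (n + 1)}
    (h : middle α α' b u w v ≠ 0) : towerP α α' b u v ≠ 0 :=
  left_ne_zero_of_mul (div_ne_zero_iff.1 h).1

/-- This holds also if the normalization vanishes, since then all its terms do. -/
theorem twoStep_mul_middle (hα : 0 < α) (hα' : 0 < α') {b : ℝ} (hb : 0 ≤ b) {n : ℕ}
    (u : W (n + 1)) (w : W n) (v : W (n + 1)) :
    twoStep α α' b u w * middle α α' b u w v = towerP α α' b u v * towerLink α α' v w := by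
  by_cases h : twoStep α α' b u w = 0
  · have h0 : ∀ v, 0 ≤ towerP α α' b u v * towerLink α α' v w := fun v =>
      mul_nonneg (towerP_nonneg hα hα' hb u v) (towerLink_nonneg hα hα' v w)
    have := (summable_twoStep hα hα' hb u w).le_tsum v fun v _ => h0 v
    rw [h, zero_mul]
    exact (le_antisymm (this.trans_eq h) (h0 v)).symm
  · exact mul_div_cancel₀ _ h

theorem tsum_middle {b : ℝ} {n : ℕ} {u : W (n + 1)} {w : W n} (h : twoStep α α' b u w ≠ 0) :
    ∑' v, middle α α' b u w v = 1 := by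
  unfold middle
  rw [tsum_div_const]
  exact div_self h

theorem twoStep_ne_zero (hα : 0 < α) (hα' : 0 < α') {b : ℝ} (hb : 0 ≤ b) {n : ℕ}
    {u : W (n + 1)} {v w : W n} (hL : towerLink α α' u v ≠ 0) (hP : towerP α α' b v w ≠ 0) :
    twoStep α α' b u w ≠ 0 := by
  rw [twoStep_eq_swap hα hα' hb]
  have h0 : ∀ v, 0 ≤ towerLink α α' u v * towerP α α' b v w := fun v =>
    mul_nonneg (towerLink_nonneg hα hα' u v) (towerP_nonneg hα hα' hb v w)
  have hs : Summable fun v => towerLink α α' u v * towerP α α' b v w :=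
    summable_of_hasFiniteSupport
      ((towerLink_support_finite hα hα' u).subset fun _ hv => left_ne_zero_of_mul hv)
  have := hs.le_tsum v fun v _ => h0 v
  exact (((h0 v).lt_of_ne (mul_ne_zero hL hP).symm).trans_le this).ne'

end Middle

/-! ### Sums over levels -/

/-- Sums over paths `x`, `y`, `z` of which each point has finitely many successors are finite. -/
theorem tsum_triple {X Y Z : Type*} (f : X × Y × Z → ℝ) {A : Set X} {B : X → Set Y}
    {C : Y → Set Z} (hA : A.Finite) (hB : ∀ x, (B x).Finite) (hC : ∀ y, (C y).Finite)
    (h : ∀ x y z, f (x, y, z) ≠ 0 → x ∈ A ∧ y ∈ B x ∧ z ∈ C y) :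
    (Function.support f).Finite ∧ ∑' p, f p = ∑' x, ∑' y, ∑' z, f (x, y, z) := by
  have hfin : (Function.support f).Finite := by
    refine (hA.biUnion fun x _ => (hB x).biUnion fun y _ =>
      (hC y).image fun z => (x, y, z)).subset ?_
    rintro ⟨x, y, z⟩ hp
    obtain ⟨h1, h2, h3⟩ := h x y z hp
    simp only [Set.mem_iUnion, Set.mem_image]
    exact ⟨x, h1, y, h2, z, h3, rfl⟩
  refine ⟨hfin, ?_⟩
  have hs : Summable f := summable_of_hasFiniteSupport hfin
  rw [hs.tsum_prod]
  exact tsum_congr fun x => (hs.prod_factor x).tsum_prod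

/-- A level as a triple, so that one can sum over `x`, then `y`, then `z`. -/
def levelEquivXYZ (k : ℕ) : Level k ≃ W (2 * k + 2) × W (2 * k + 1) × W (2 * k) where
  toFun l := (l.x, l.y, l.z)
  invFun p := ⟨p.1, p.2.1, p.2.2⟩
  left_inv _ := rfl
  right_inv _ := rfl

/-- A level as a triple, so that one can sum over `z`, then `y`, then `x`. -/
def levelEquivZYX (k : ℕ) : Level k ≃ W (2 * k) × W (2 * k + 1) × W (2 * k + 2) where
  toFun l := (l.z, l.y, l.x)
  invFun p := ⟨p.2.2, p.2.1, p.1⟩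
  left_inv _ := rfl
  right_inv _ := rfl

section Chain

variable {α α' β : ℝ}

/-- One step of a single level, with a law `e` of the old `x`: summing over the old `z` and then over
the old `y` turns the links into two-step kernels, by commutation, and these cancel the
normalizations. -/
theorem tsum_level_step (hα : 0 < α) (hα' : 0 < α') {b : ℝ} (hb : 0 ≤ b) {k : ℕ}
    {e : W (2 * k + 2) → ℝ} (he : (Function.support e).Finite) (l' : Level k) :
    (Function.support fun l : Level k =>
      e l.x * (towerLink α α' l.x l.y * (towerLink α α' l.y l.z * towerP α α' b l.z l'.z)) *
        (middle α α' b l.y l'.z l'.y * middle α α' b l.x l'.y l'.x)).Finite ∧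
    ∑' l : Level k,
      e l.x * (towerLink α α' l.x l.y * (towerLink α α' l.y l.z * towerP α α' b l.z l'.z)) *
        (middle α α' b l.y l'.z l'.y * middle α α' b l.x l'.y l'.x) =
      (∑' u, e u * towerP α α' b u l'.x) *
        (towerLink α α' l'.x l'.y * towerLink α α' l'.y l'.z) := by
  obtain ⟨hfin, hsum⟩ := tsum_triple (fun p : W (2 * k + 2) × W (2 * k + 1) × W (2 * k) =>
      e p.1 * (towerLink α α' p.1 p.2.1 *
        (towerLink α α' p.2.1 p.2.2 * towerP α α' b p.2.2 l'.z)) *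
        (middle α α' b p.2.1 l'.z l'.y * middle α α' b p.1 l'.y l'.x)) he
      (towerLink_support_finite hα hα') (towerLink_support_finite hα hα')
      (fun x y z h => by
        have h1 := left_ne_zero_of_mul h
        have h2 := right_ne_zero_of_mul h1
        exact ⟨left_ne_zero_of_mul h1, left_ne_zero_of_mul h2,
          left_ne_zero_of_mul (right_ne_zero_of_mul h2)⟩)
  refine ⟨hfin.preimage (levelEquivXYZ k).injective.injOn, ?_⟩
  refine ((levelEquivXYZ k).tsum_eq _).trans (hsum.trans ?_)
  have hz : ∀ x y, ∑' z, e x * (towerLink α α' x y *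
        (towerLink α α' y z * towerP α α' b z l'.z)) *
        (middle α α' b y l'.z l'.y * middle α α' b x l'.y l'.x) =
      e x * middle α α' b x l'.y l'.x * towerLink α α' l'.y l'.z *
        (towerLink α α' x y * towerP α α' b y l'.y) := by
    intro x y
    have : ∀ z, e x * (towerLink α α' x y * (towerLink α α' y z * towerP α α' b z l'.z)) *
        (middle α α' b y l'.z l'.y * middle α α' b x l'.y l'.x) =
        e x * towerLink α α' x y * middle α α' b x l'.y l'.x * middle α α' b y l'.z l'.y *
          (towerLink α α' y z * towerP α α' b z l'.z) := fun z => by ring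
    simp only [this]
    rw [tsum_mul_left, ← twoStep_eq_swap hα hα' hb]
    linear_combination (e x * towerLink α α' x y * middle α α' b x l'.y l'.x) *
      twoStep_mul_middle hα hα' hb y l'.z l'.y
  simp only [hz]
  rw [← tsum_mul_right]
  refine tsum_congr fun x => ?_
  rw [tsum_mul_left, ← twoStep_eq_swap hα hα' hb]
  linear_combination (e x * towerLink α α' l'.y l'.z) * twoStep_mul_middle hα hα' hb x l'.y l'.x

/-! ### The law of the chain -/

theorem weightAt_nonneg (hβ : 0 ≤ β) (τ : ℤ) : 0 ≤ weightAt β τ := by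
  unfold weightAt; split_ifs <;> simp [hβ]

/-- The vector that becomes `z` of level `k + 1` in the next step: `x` of the level below, and the
empty vector for the first level. -/
def prevX {N : ℕ} (c : Config N) : ∀ k : Fin N, W (2 * k)
  | ⟨0, _⟩ => packed 0
  | ⟨k + 1, h⟩ => (c ⟨k, Nat.lt_of_succ_lt h⟩).x

open Classical in
/-- The transition probability of a single level. -/
def levelTransition (α α' β : ℝ) {N : ℕ} (t : ℕ) (c : Config N) (k : Fin N) (l : Level k) : ℝ :=
  (if l.z = prevX c k then 1 else 0) *
    (middle α α' (weightAt β ((t : ℤ) - (k : ℕ))) (c k).y l.z l.y *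
      middle α α' (weightAt β ((t : ℤ) - (k : ℕ))) (c k).x l.y l.x)

theorem transition_eq {N : ℕ} (t : ℕ) (c c' : Config N) :
    transition α α' β t c c' = ∏ k, levelTransition α α' β t c k (c' k) := by
  classical
  unfold transition levelTransition
  rw [Finset.prod_mul_distrib (f := fun k => if (c' k).z = prevX c k then (1 : ℝ) else 0)]
  congr 1
  symm
  split_ifs with h
  · refine Finset.prod_eq_one fun k _ => if_pos ?_
    obtain ⟨k, hk⟩ := k
    cases k with
    | zero => exact Subsingleton.elim (α := W 0) _ _
    | succ k => exact h k hk
  · push Not at h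
    obtain ⟨k, hk, hne⟩ := h
    exact Finset.prod_eq_zero (Finset.mem_univ ⟨k + 1, hk⟩) (if_neg hne)

open Classical in
/-- The law at time `t` of the vector `x` of level `k + 1`. -/
def topLaw (α α' β : ℝ) (k : ℕ) : ℕ → W (2 * k + 2) → ℝ
  | 0, x => if x = packed _ then 1 else 0
  | t + 1, x => ∑' u, topLaw α α' β k t u * towerP α α' (weightAt β ((t : ℤ) - (k : ℕ))) u x

/-- The law at time `t` of the whole configuration. Down from the vector `x` of the last level, the
vectors form a Markov chain, with the links inside a level and the step from `z` of a level to `x`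
of the level below. -/
def configLaw (α α' β : ℝ) {M : ℕ} (t : ℕ) (c : Config (M + 1)) : ℝ :=
  topLaw α α' β M t (c (Fin.last M)).x *
    ∏ k, (towerLink α α' (c k).x (c k).y * (towerLink α α' (c k).y (c k).z *
      towerP α α' (weightAt β ((t : ℤ) - (k : ℕ))) (c k).z (prevX c k)))

theorem topLaw_support_finite (hα : 0 < α) (hα' : 0 < α') (hβ : 0 ≤ β) (k : ℕ) :
    ∀ t, (Function.support (topLaw α α' β k t)).Finite
  | 0 => (Set.finite_singleton (packed _)).subset fun x hx => by
      by_contra h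
      exact hx (if_neg h)
  | t + 1 => by
    refine ((topLaw_support_finite hα hα' hβ k t).biUnion fun u _ =>
      towerP_support_finite hα hα' (weightAt_nonneg hβ ((t : ℤ) - (k : ℕ))) u).subset ?_
    intro x hx
    by_contra hcon
    simp only [Set.mem_iUnion, Function.mem_support, not_exists] at hcon
    refine hx ((tsum_congr fun u => ?_).trans tsum_zero)
    by_cases h : topLaw α α' β k t u = 0
    · rw [h, zero_mul]
    · rw [not_ne_iff.1 (hcon u h), mul_zero]

theorem configLaw_zero_ne_zero (hα : 0 < α) (hα' : 0 < α') {M : ℕ} {c : Config (M + 1)}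
    (h : configLaw α α' β 0 c ≠ 0) : c = packedConfig (M + 1) := by
  have htop : (c (Fin.last M)).x = packed _ := by
    by_contra hcon
    exact left_ne_zero_of_mul h (if_neg hcon)
  have hk := fun k => Finset.prod_ne_zero_iff.1 (right_ne_zero_of_mul h) k (Finset.mem_univ k)
  have hy : ∀ k, (c k).x = packed _ → (c k).y = packed _ := by
    intro k hx
    have := left_ne_zero_of_mul (hk k)
    rw [hx, towerLink_packed hα hα'] at this
    by_contra hcon
    exact this (if_neg hcon)
  have hz : ∀ k, (c k).x = packed _ → (c k).z = packed _ := by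
    intro k hx
    have := left_ne_zero_of_mul (right_ne_zero_of_mul (hk k))
    rw [hy k hx, towerLink_packed hα hα'] at this
    by_contra hcon
    exact this (if_neg hcon)
  have hx : ∀ k, (c k).x = packed _ := by
    intro k
    induction k using Fin.reverseInduction with
    | last => exact htop
    | cast k ih =>
      have h1 := right_ne_zero_of_mul (right_ne_zero_of_mul (hk k.succ))
      have h2 : weightAt β (((0 : ℕ) : ℤ) - ((k.succ : Fin (M + 1)) : ℕ)) = 0 := by
        refine if_neg ?_
        rw [Fin.val_succ]
        push_cast
        omega
      rw [h2, towerP_zero hα hα', hz _ ih] at h1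
      by_contra hcon
      exact h1 (if_neg fun h => hcon h.symm)
  funext k
  have e1 := hx k
  have e2 := hy k e1
  have e3 := hz k e1
  revert e1 e2 e3
  generalize c k = l
  cases l
  rintro rfl rfl rfl
  rfl

open Classical in
theorem configLaw_zero (hα : 0 < α) (hα' : 0 < α') (hβ : 0 ≤ β) {M : ℕ} (c : Config (M + 1)) :
    configLaw α α' β 0 c = if c = packedConfig (M + 1) then 1 else 0 := by
  split_ifs with h
  · subst h
    have h1 : topLaw α α' β M 0 (packed (2 * M + 2)) = 1 := if_pos rfl
    have h2 : ∀ n, towerLink α α' (packed (n + 1)) (packed n) = 1 := fun n => by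
      rw [towerLink_packed hα hα', if_pos rfl]
    have h3 : ∀ k : Fin (M + 1), towerP α α' (weightAt β (((0 : ℕ) : ℤ) - (k : ℕ)))
        (packed (2 * k)) (prevX (packedConfig (M + 1)) k) = 1 := by
      rintro ⟨k, hk⟩
      cases k with
      | zero => exact towerP_empty hα hα' (weightAt_nonneg hβ _) _ _
      | succ k =>
        have h2 : weightAt β (((0 : ℕ) : ℤ) - ((k + 1 : ℕ) : ℤ)) = 0 :=
          if_neg (by push_cast; omega)
        have h3 := towerP_zero hα hα' (packed (2 * (k + 1))) (packed (2 * (k + 1)))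
        rw [if_pos rfl, ← h2] at h3
        exact h3
    refine (congrArg₂ (· * ·) h1 (Finset.prod_eq_one fun k _ => ?_)).trans (mul_one 1)
    exact (congrArg₂ (· * ·) (h2 _) (congrArg₂ (· * ·) (h2 _) (h3 k))).trans (by norm_num)
  · by_contra hcon
    exact h (configLaw_zero_ne_zero hα hα' hcon)

open Classical in
theorem tsum_indicator_mul {n : ℕ} (w : W n) {f : W n → ℝ}
    (hf : ∀ u, f u = if w = u then 1 else 0) (g : W n → ℝ) : ∑' u, f u * g u = g w := by
  have : ∑' u, f u * g u = f w * g w :=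
    tsum_eq_single w fun u hu => by rw [hf, if_neg hu.symm, zero_mul]
  rw [this, hf, if_pos rfl, one_mul]

/-- One step of the chain preserves the form of the law. For fixed new `c`, the summand is a product
over levels: the indicators in the transition replace the old `x` below a level by the new `z`. -/
theorem tsum_configLaw_transition (hα : 0 < α) (hα' : 0 < α') (hβ : 0 ≤ β) {M : ℕ} (t : ℕ)
    (c : Config (M + 1)) :
    ∑' c₀, configLaw α α' β t c₀ * transition α α' β t c₀ c = configLaw α α' β (t + 1) c := by
  classical
  -- given the new `z` of the next level, the old `x` is known, except on the last level
  let e (k : Fin (M + 1)) (u : W (2 * k + 2)) : ℝ :=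
    if h : (k : ℕ) + 1 < M + 1 then (if (c ⟨k + 1, h⟩).z = u then 1 else 0)
    else topLaw α α' β k t u
  have he : ∀ k, (Function.support (e k)).Finite := by
    intro k
    by_cases h : (k : ℕ) + 1 < M + 1
    · refine (Set.finite_singleton (α := W (2 * k + 2)) (c ⟨k + 1, h⟩).z).subset fun u hu => ?_
      by_contra hcon
      refine hu ?_
      simp only [e, dif_pos h]
      exact if_neg fun h => hcon h.symm
    · have : e k = topLaw α α' β k t := funext fun u => dif_neg h
      rw [this]
      exact topLaw_support_finite hα hα' hβ k t
  let H (k : Fin (M + 1)) (l : Level k) : ℝ :=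
    e k l.x * (towerLink α α' l.x l.y * (towerLink α α' l.y l.z *
        towerP α α' (weightAt β ((t : ℤ) - (k : ℕ))) l.z (c k).z)) *
        (middle α α' (weightAt β ((t : ℤ) - (k : ℕ))) l.y (c k).z (c k).y *
          middle α α' (weightAt β ((t : ℤ) - (k : ℕ))) l.x (c k).y (c k).x)
  have hH := fun k => tsum_level_step hα hα' (weightAt_nonneg hβ ((t : ℤ) - ((k : Fin (M + 1)) : ℕ)))
    (he k) (c k)
  have hfactor : ∀ c₀, configLaw α α' β t c₀ * transition α α' β t c₀ c =
      ∏ k, H k (c₀ k) := by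
    intro c₀
    have hind : ∏ k, e k (c₀ k).x = topLaw α α' β M t (c₀ (Fin.last M)).x *
        ∏ k, (if (c k).z = prevX c₀ k then (1 : ℝ) else 0) := by
      rw [Fin.prod_univ_castSucc, Fin.prod_univ_succ, mul_comm]
      have h1 : e (Fin.last M) (c₀ (Fin.last M)).x = topLaw α α' β M t (c₀ (Fin.last M)).x :=
        dif_neg (by simp)
      have h2 : (if (c 0).z = prevX c₀ 0 then (1 : ℝ) else 0) = 1 :=
        if_pos (Subsingleton.elim (α := W 0) _ _)
      rw [h1, h2, one_mul]
      congr 1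
      refine Finset.prod_congr rfl fun k _ => ?_
      exact dif_pos (by simp)
    rw [transition_eq, configLaw]
    simp only [H, levelTransition, Finset.prod_mul_distrib]
    rw [hind]
    have hP : (∏ k, (if (c k).z = prevX c₀ k then (1 : ℝ) else 0)) *
        ∏ k, towerP α α' (weightAt β ((t : ℤ) - ((k : Fin (M + 1)) : ℕ))) (c₀ k).z (prevX c₀ k) =
        (∏ k, (if (c k).z = prevX c₀ k then (1 : ℝ) else 0)) *
        ∏ k, towerP α α' (weightAt β ((t : ℤ) - ((k : Fin (M + 1)) : ℕ))) (c₀ k).z (c k).z := by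
      rw [← Finset.prod_mul_distrib, ← Finset.prod_mul_distrib]
      refine Finset.prod_congr rfl fun k _ => ?_
      split_ifs with h
      · rw [h]
      · simp
    linear_combination (topLaw α α' β M t (c₀ (Fin.last M)).x *
      (∏ k, towerLink α α' (c₀ k).x (c₀ k).y) * (∏ k, towerLink α α' (c₀ k).y (c₀ k).z) *
      (∏ k, middle α α' (weightAt β ((t : ℤ) - ((k : Fin (M + 1)) : ℕ)))
        (c₀ k).y (c k).z (c k).y) *
      (∏ k, middle α α' (weightAt β ((t : ℤ) - ((k : Fin (M + 1)) : ℕ)))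
        (c₀ k).x (c k).y (c k).x)) * hP
  simp only [hfactor]
  rw [(hasSum_pi_prod H fun k => (hH k).1).tsum_eq, Finset.prod_congr rfl fun k _ => (hH k).2,
    Finset.prod_mul_distrib, configLaw]
  have hlast : ∑' u, e (Fin.last M) u * towerP α α' (weightAt β ((t : ℤ) - (M : ℕ))) u
      (c (Fin.last M)).x = topLaw α α' β M (t + 1) (c (Fin.last M)).x := by
    refine tsum_congr fun u => ?_
    congr 1
    exact dif_neg (by simp)
  have hother : ∀ k : Fin M, ∑' u, e k.castSucc u *
      towerP α α' (weightAt β ((t : ℤ) - (k : ℕ))) u (c k.castSucc).x =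
      towerP α α' (weightAt β (((t + 1 : ℕ) : ℤ) - (k.succ : ℕ))) (c k.succ).z
        (prevX c k.succ) := by
    intro k
    have h1 : ∀ u : W (2 * k + 2), e k.castSucc u =
        if (c k.succ).z = u then 1 else 0 := fun u => dif_pos (by simp)
    have h2 : ((t + 1 : ℕ) : ℤ) - (k.succ : ℕ) = (t : ℤ) - (k : ℕ) := by
      rw [Fin.val_succ]; push_cast; ring
    rw [h2]
    exact tsum_indicator_mul (n := 2 * k + 2) (c k.succ).z h1
      (fun u => towerP α α' (weightAt β ((t : ℤ) - (k : ℕ))) u (c k.castSucc).x)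
  have hzero : towerP α α' (weightAt β (((t + 1 : ℕ) : ℤ) - ((0 : Fin (M + 1)) : ℕ))) (c 0).z
      (prevX c 0) = 1 := towerP_empty hα hα' (weightAt_nonneg hβ _) _ _
  have hsteps : ∏ k : Fin (M + 1), ∑' u, e k u *
      towerP α α' (weightAt β ((t : ℤ) - (k : ℕ))) u (c k).x =
      topLaw α α' β M (t + 1) (c (Fin.last M)).x *
      ∏ k : Fin (M + 1), towerP α α' (weightAt β (((t + 1 : ℕ) : ℤ) - (k : ℕ))) (c k).z
        (prevX c k) := by
    rw [Fin.prod_univ_castSucc, Fin.prod_univ_succ (n := M), hzero, one_mul, mul_comm]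
    exact congrArg₂ (· * ·) hlast (Finset.prod_congr rfl fun k _ => hother k)
  rw [hsteps]
  simp only [Finset.prod_mul_distrib]
  ring

theorem chainLaw_eq (hα : 0 < α) (hα' : 0 < α') (hβ : 0 ≤ β) {M : ℕ} :
    ∀ (t : ℕ) (c : Config (M + 1)), chainLaw α α' β (M + 1) t c = configLaw α α' β t c
  | 0, c => by rw [configLaw_zero hα hα' hβ, chainLaw]
  | t + 1, c => by
    rw [chainLaw, ← tsum_configLaw_transition hα hα' hβ]
    exact tsum_congr fun c₀ => by rw [chainLaw_eq hα hα' hβ t c₀]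

/-! ### Total mass -/

theorem chainLaw_nonneg (hα : 0 < α) (hα' : 0 < α') (hβ : 0 ≤ β) {N : ℕ} :
    ∀ (t : ℕ) (c : Config N), 0 ≤ chainLaw α α' β N t c
  | 0, c => by rw [chainLaw]; split_ifs <;> simp
  | t + 1, c => by
    rw [chainLaw]
    refine tsum_nonneg fun c₀ => mul_nonneg (chainLaw_nonneg hα hα' hβ t c₀) ?_
    rw [transition_eq]
    refine Finset.prod_nonneg fun k _ => mul_nonneg (by split_ifs <;> simp) ?_
    have hb := weightAt_nonneg hβ ((t : ℤ) - (k : ℕ))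
    exact mul_nonneg (middle_nonneg hα hα' hb _ _ _) (middle_nonneg hα hα' hb _ _ _)

/-- From a configuration of positive probability, the normalizations in the transition do not
vanish: by commutation, the old vectors give a path that goes down a link and then makes a step. -/
theorem levelTransition_mass (hα : 0 < α) (hα' : 0 < α') (hβ : 0 ≤ β) {M : ℕ} {t : ℕ}
    {c : Config (M + 1)} (hc : configLaw α α' β t c ≠ 0) (k : Fin (M + 1)) :
    (Function.support (levelTransition α α' β t c k)).Finite ∧
      ∑' l, levelTransition α α' β t c k l = 1 := by
  classical
  have hb := weightAt_nonneg hβ ((t : ℤ) - (k : ℕ))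
  have hk := Finset.prod_ne_zero_iff.1 (right_ne_zero_of_mul hc) k (Finset.mem_univ k)
  have hxy := left_ne_zero_of_mul hk
  have hyz := left_ne_zero_of_mul (right_ne_zero_of_mul hk)
  have hzx := right_ne_zero_of_mul (right_ne_zero_of_mul hk)
  obtain ⟨hfin, hsum⟩ := tsum_triple (fun p : W (2 * k) × W (2 * k + 1) × W (2 * k + 2) =>
      (if p.1 = prevX c k then (1 : ℝ) else 0) *
      (middle α α' (weightAt β ((t : ℤ) - (k : ℕ))) (c k).y p.1 p.2.1 *
        middle α α' (weightAt β ((t : ℤ) - (k : ℕ))) (c k).x p.2.1 p.2.2))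
      (Set.finite_singleton (prevX c k)) (fun _ => towerP_support_finite hα hα' hb (c k).y)
      (fun _ => towerP_support_finite hα hα' hb (c k).x)
      (fun z y x h => by
        refine ⟨?_, towerP_ne_zero_of_middle (left_ne_zero_of_mul (right_ne_zero_of_mul h)),
          towerP_ne_zero_of_middle (right_ne_zero_of_mul (right_ne_zero_of_mul h))⟩
        by_contra hcon
        exact left_ne_zero_of_mul h (if_neg hcon))
  refine ⟨hfin.preimage (levelEquivZYX k).injective.injOn, ?_⟩
  refine ((levelEquivZYX k).tsum_eq _).trans (hsum.trans ?_)
  refine (tsum_eq_single (prevX c k) fun z hz => ?_).trans ?_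
  · simp [hz]
  · simp only [if_true, one_mul]
    rw [← tsum_middle (twoStep_ne_zero hα hα' hb hyz hzx)]
    refine tsum_congr fun y => ?_
    by_cases hy : middle α α' (weightAt β ((t : ℤ) - (k : ℕ))) (c k).y (prevX c k) y = 0
    · simp [hy]
    · rw [tsum_mul_left, tsum_middle (twoStep_ne_zero hα hα' hb hxy (towerP_ne_zero_of_middle hy)),
        mul_one]

theorem chainLaw_mass (hα : 0 < α) (hα' : 0 < α') (hβ : 0 ≤ β) {M : ℕ} :
    ∀ t, (Function.support (chainLaw α α' β (M + 1) t)).Finite ∧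
      HasSum (chainLaw α α' β (M + 1) t) 1
  | 0 => by
    classical
    constructor
    · refine (Set.finite_singleton (packedConfig (M + 1))).subset fun c hc => ?_
      by_contra h
      exact hc (if_neg h)
    · have : chainLaw α α' β (M + 1) 0 = fun c => if c = packedConfig (M + 1) then 1 else 0 := by
        funext c; rw [chainLaw]
      rw [this]
      exact hasSum_ite_eq _ _
  | t + 1 => by
    obtain ⟨hfin, hsum⟩ := chainLaw_mass hα hα' hβ (M := M) t
    have hT : ∀ c₀ ∈ hfin.toFinset, (Function.support (transition α α' β t c₀)).Finite ∧
        HasSum (transition α α' β t c₀) 1 := by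
      intro c₀ h₀
      have hc : configLaw α α' β t c₀ ≠ 0 := by
        rw [← chainLaw_eq hα hα' hβ]; simpa using h₀
      have hl := levelTransition_mass hα hα' hβ hc
      have heq : transition α α' β t c₀ = fun c => ∏ k, levelTransition α α' β t c₀ k (c k) :=
        funext fun c => transition_eq t c₀ c
      have := hasSum_pi_prod _ fun k => (hl k).1
      rw [Finset.prod_eq_one fun k _ => (hl k).2] at this
      rw [heq]
      exact ⟨support_pi_prod_finite _ fun k => (hl k).1, this⟩
    have heq : chainLaw α α' β (M + 1) (t + 1) = fun c => ∑ c₀ ∈ hfin.toFinset,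
        chainLaw α α' β (M + 1) t c₀ * transition α α' β t c₀ c := by
      funext c
      rw [chainLaw]
      refine tsum_eq_sum fun c₀ h₀ => ?_
      have : chainLaw α α' β (M + 1) t c₀ = 0 := by simpa using h₀
      rw [this, zero_mul]
    rw [heq]
    constructor
    · refine (hfin.toFinset.finite_toSet.biUnion fun c₀ h₀ => (hT c₀ h₀).1).subset fun c hc => ?_
      obtain ⟨c₀, h₀, h⟩ := Finset.exists_ne_zero_of_sum_ne_zero hc
      simp only [Set.mem_iUnion]
      exact ⟨c₀, h₀, right_ne_zero_of_mul h⟩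
    · have h1 : ∑ c₀ ∈ hfin.toFinset, chainLaw α α' β (M + 1) t c₀ * 1 = 1 := by
        simp only [mul_one]
        rw [← hsum.tsum_eq]
        exact (tsum_eq_sum fun c₀ h₀ => by simpa using h₀).symm
      rw [← h1]
      exact hasSum_sum fun c₀ h₀ => (hT c₀ h₀).2.mul_left _

end Chain

/-! ### The contour integrals -/

theorem circleIntegral_zpow (m : ℤ) :
    (∮ z in C(0, 1), z ^ m : ℂ) = if m = -1 then 2 * (Real.pi : ℂ) * Complex.I else 0 := by
  split_ifs with h
  · subst h
    have := circleIntegral.integral_sub_center_inv (0 : ℂ) (one_ne_zero (α := ℝ))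
    simpa [zpow_neg_one] using this
  · have := circleIntegral.integral_sub_zpow_of_ne h (0 : ℂ) 0 1
    simpa using this

theorem circleIntegrable_zpow (m : ℤ) : CircleIntegrable (fun z : ℂ => z ^ m) 0 1 := by
  have := circleIntegrable_sub_zpow_iff (c := (0 : ℂ)) (w := 0) (R := 1) (n := m)
  simp only [sub_zero] at this
  rw [this]
  right; right
  simp

/-- Expanding `(1 - z) ^ (M - i)` shows that `psiTilde` is a combination of step functions. -/
theorem psiTilde_eq (β : ℝ) (M i : ℕ) (x : ℤ) :
    psiTilde β M i x = ∑ k ∈ Finset.range (M - i + 1),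
      ((-1) ^ k * ((M - i).choose k : ℂ)) * (stepFun β (-((i : ℤ) + k) - x) : ℂ) := by
  have hpi : (2 * (Real.pi : ℂ) * Complex.I) ≠ 0 := Complex.two_pi_I_ne_zero
  have hcongr : (∮ z in C(0, 1), (1 - z) ^ (M - i) * z ^ (x + (i : ℤ) - 1) * (1 + (β : ℂ) / z)) =
      ∮ z in C(0, 1), ∑ k ∈ Finset.range (M - i + 1), ((-1) ^ k * ((M - i).choose k : ℂ)) *
        (z ^ (x + (i : ℤ) - 1 + k) + (β : ℂ) * z ^ (x + (i : ℤ) - 2 + k)) := by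
    refine circleIntegral.integral_congr zero_le_one fun z hz => ?_
    have hz0 : z ≠ 0 := by
      rintro rfl
      simp at hz
    rw [sub_eq_neg_add, add_pow, Finset.sum_mul, Finset.sum_mul]
    refine Finset.sum_congr rfl fun k _ => ?_
    rw [zpow_add₀ hz0 _ (k : ℤ), zpow_add₀ hz0 _ (k : ℤ),
      show x + (i : ℤ) - 1 = (x + (i : ℤ) - 2) + 1 by ring, zpow_add_one₀ hz0, zpow_natCast,
      neg_pow z]
    field_simp
    ring
  have hβi : ∀ m : ℤ, CircleIntegrable (fun z : ℂ => (β : ℂ) * z ^ m) 0 1 := fun m =>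
    (circleIntegrable_zpow m).const_fun_smul (a := (β : ℂ))
  have hint : ∀ k : ℕ, CircleIntegrable (fun z : ℂ => ((-1) ^ k * ((M - i).choose k : ℂ)) *
        (z ^ (x + (i : ℤ) - 1 + k) + (β : ℂ) * z ^ (x + (i : ℤ) - 2 + k))) 0 1 := fun k =>
    ((circleIntegrable_zpow _).add (hβi _)).const_fun_smul
  rw [psiTilde, hcongr, circleIntegral.integral_fun_sum fun k _ => hint k, Finset.mul_sum]
  refine Finset.sum_congr rfl fun k _ => ?_
  rw [circleIntegral.integral_const_mul, circleIntegral.integral_add (circleIntegrable_zpow _)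
    (hβi _),
    circleIntegral.integral_const_mul, circleIntegral_zpow, circleIntegral_zpow, stepFun]
  have e1 : x + (i : ℤ) - 1 + k = -1 ↔ -((i : ℤ) + k) - x = 0 := by omega
  have e2 : x + (i : ℤ) - 2 + k = -1 ↔ -((i : ℤ) + k) - x = -1 := by omega
  simp only [e1, e2]
  push_cast
  split_ifs <;> field_simp <;> (try simp) <;> ring

/-- Up to the sign of the reversal of rows, the matrix of `psiTilde` is a unitriangular matrix times
the matrix of steps from the packed vector. -/
theorem psiTildeDet_eq (β : ℝ) {M : ℕ} (x : W M) :
    psiTildeDet β x = ((Equiv.Perm.sign (Fin.revPerm (n := M)) : ℤ) : ℂ) *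
      (step β (packed M) x : ℂ) := by
  let T : Matrix (Fin M) (Fin M) ℂ := Matrix.of fun i l =>
    if (l : ℕ) ≤ i then (-1) ^ ((i : ℕ) - l) * ((i : ℕ).choose (i - l) : ℂ) else 0
  let S : Matrix (Fin M) (Fin M) ℝ := Matrix.of fun l j => stepFun β ((packed M).1 l - x.1 j)
  have hT : T.det = 1 := by
    rw [Matrix.det_of_isLowerTriangular]
    · simp [T]
    · intro i j hij
      have : ¬ ((j : ℕ) ≤ i) := not_le.2 (by simpa using hij)
      exact if_neg this
  have hmul : Matrix.of (fun i j : Fin M => psiTilde β M ((i : ℕ) + 1) (x.1 j)) =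
      (T * S.map (algebraMap ℝ ℂ)).submatrix Fin.revPerm id := by
    ext i j
    simp only [Matrix.of_apply, psiTilde_eq, Matrix.submatrix_apply, Matrix.mul_apply, id]
    have hM : M - (i + 1) < M := by omega
    rw [← Finset.sum_range_reflect, ← Finset.sum_subset
      (s₁ := Finset.univ.filter fun l : Fin M => (l : ℕ) < M - (i + 1) + 1)
      (Finset.filter_subset _ _)]
    · symm
      refine Finset.sum_bij (fun l _ => (l : ℕ)) (by simp) (fun a _ b _ h => Fin.ext h) ?_ ?_
      · intro k hk
        rw [Finset.mem_range] at hk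
        exact ⟨⟨k, by omega⟩, by simpa using hk, rfl⟩
      · intro l hl
        simp only [Finset.mem_filter, Finset.mem_univ, true_and] at hl
        have h1 : ((Fin.revPerm i : Fin M) : ℕ) = M - (i + 1) := by simp [Fin.val_rev]
        simp only [T, S, Matrix.of_apply, Matrix.map_apply, h1, Complex.coe_algebraMap]
        rw [if_pos (by omega), show M - (i + 1) + 1 - 1 - (l : ℕ) = M - (i + 1) - l by omega]
        congr 3
        simp only [packed]
        push_cast [show (l : ℕ) ≤ M - (i + 1) by omega, show (i : ℕ) + 1 ≤ M by omega]
        ring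
    · intro l _ hl
      have h1 : ((Fin.revPerm i : Fin M) : ℕ) = M - (i + 1) := by simp [Fin.val_rev]
      simp only [Finset.mem_filter, Finset.mem_univ, true_and] at hl
      simp only [T, Matrix.of_apply, h1]
      rw [if_neg (by omega), zero_mul]
  rw [psiTildeDet, hmul, Matrix.det_permute, Matrix.det_mul, hT, one_mul]
  congr 1
  have := RingHom.map_det (algebraMap ℝ ℂ) S
  rw [RingHom.mapMatrix_apply] at this
  rw [← this, det_stepFun]
  rfl

/-! ### The product formula -/

section Formula

variable {α α' β : ℝ}

theorem linkWeight_eq (w : ℝ) {n : ℕ} (x : W (n + 1)) (y : W n) :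
    linkWeight w x y = phiDet x y * w ^ (∑ i, x.1 i - ∑ i, y.1 i) := by
  rw [linkWeight, phiDet_eq]
  split_ifs <;> simp

theorem fTildeDet_eq (β : ℝ) {n : ℕ} (x z : W n) : fTildeDet β x z = step β z x := by
  rw [step, ← det_stepFun, fTildeDet, ← Matrix.det_transpose]
  congr 1
  ext i j
  simp only [Matrix.transpose_apply, Matrix.of_apply, fTilde, stepFun]
  have e1 : x.1 j - z.1 i = 0 ↔ z.1 i - x.1 j = 0 := by omega
  have e2 : x.1 j - z.1 i = 1 ↔ z.1 i - x.1 j = -1 := by omega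
  simp only [e1, e2]

theorem weightF_eq (hα : 0 < α) (hα' : 0 < α') {k : ℕ} (l : Level k) :
    weightF α α' l = α' ^ (∑ i, l.x.1 i - ∑ i, l.y.1 i) * α ^ (∑ i, l.y.1 i - ∑ i, l.z.1 i) := by
  rw [weightF, ← zpow_sum₀ hα'.ne', ← zpow_sum₀ (div_pos hα hα').ne',
    ← zpow_sum₀ (one_div_pos.2 hα).ne', zpow_sub₀ hα'.ne', zpow_sub₀ hα.ne', div_zpow, div_zpow,
    one_zpow]
  ring

theorem levelLaw_eq (hα : 0 < α) (hα' : 0 < α') {b : ℝ} (hb : 0 ≤ b) {k : ℕ} (l : Level k)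
    (p : W (2 * k)) :
    towerLink α α' l.x l.y * (towerLink α α' l.y l.z * towerP α α' b l.z p) =
      (phiDet l.x l.y * phiDet l.y l.z) * weightF α α' l * step b l.z p *
        (∏ j, (1 + b * towerWeights α α' (2 * k) j))⁻¹ *
        schur (towerWeights α α' (2 * k)) p * (schur (towerWeights α α' (2 * k + 2)) l.x)⁻¹ := by
  have h1 : towerWeights α α' (2 * k + 1 + 1) (Fin.last _) = α' := by
    simp [towerWeights]
  have h2 : towerWeights α α' (2 * k + 1) (Fin.last _) = α := by
    simp [towerWeights]
  have hy := (schur_pos (towerWeights_pos hα hα') l.y).ne'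
  have hz := (schur_pos (towerWeights_pos hα hα') l.z).ne'
  rw [towerLink_eq hα hα', towerLink_eq hα hα', towerP_eq hα hα' hb, linkWeight_eq,
    linkWeight_eq, weightF_eq hα hα', h1, h2]
  field_simp

theorem topLaw_early (hα : 0 < α) (hα' : 0 < α') {k : ℕ} :
    ∀ {t : ℕ}, t ≤ k → topLaw α α' β k t = topLaw α α' β k 0
  | 0, _ => rfl
  | t + 1, h => by
    classical
    have h0 : weightAt β ((t : ℤ) - (k : ℕ)) = 0 := if_neg (by omega)
    funext x
    have ih : topLaw α α' β k t = topLaw α α' β k 0 := topLaw_early hα hα' (by omega)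
    change ∑' u, topLaw α α' β k t u * towerP α α' (weightAt β ((t : ℤ) - (k : ℕ))) u x = _
    rw [ih, h0]
    refine (tsum_eq_single x fun u hu => ?_).trans ?_
    · rw [towerP_zero hα hα', if_neg hu, mul_zero]
    · rw [towerP_zero hα hα', if_pos rfl, mul_one]

theorem topLaw_final (hα : 0 < α) (hα' : 0 < α') (k : ℕ) (x : W (2 * k + 2)) :
    topLaw α α' β k (k + 1) x = towerP α α' β (packed _) x := by
  have h0 : weightAt β ((k : ℤ) - (k : ℕ)) = β := if_pos (by simp)
  rw [topLaw, topLaw_early hα hα' le_rfl, h0]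
  exact tsum_indicator_mul (packed _) (fun u => by
    rw [topLaw]
    exact if_congr eq_comm rfl rfl) (fun u => towerP α α' β u x)

/-- The Schur functions telescope along the configuration, and the determinants remain. -/
theorem exists_configLaw_eq (hα : 0 < α) (hα' : 0 < α') (hβ : 0 ≤ β) (M : ℕ) :
    ∃ C : ℝ, ∀ c : Config (M + 1), configLaw α α' β (M + 1) c =
      C * step β (packed (2 * M + 2)) (c (Fin.last M)).x *
        (∏ k, (phiDet (c k).x (c k).y * phiDet (c k).y (c k).z)) *
        (∏ k : Fin M, fTildeDet β (n := 2 * ((k : ℕ) + 1)) (c k.castSucc).x (c k.succ).z) *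
        ∏ k, weightF α α' (c k) := by
  refine ⟨(schur (towerWeights α α' (2 * M + 2)) (packed _))⁻¹ *
    (∏ j, (1 + β * towerWeights α α' (2 * M + 2) j))⁻¹ *
    ∏ k : Fin (M + 1), (∏ j, (1 + β * towerWeights α α' (2 * k) j))⁻¹, fun c => ?_⟩
  have hw : ∀ k : Fin (M + 1), weightAt β (((M + 1 : ℕ) : ℤ) - (k : ℕ)) = β := fun k =>
    if_pos (by have := k.2; omega)
  have hx := (schur_pos (towerWeights_pos hα hα') (n := 2 * M + 2) (c (Fin.last M)).x).ne'
  have hpx := fun k : Fin M =>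
    (schur_pos (towerWeights_pos hα hα') (n := 2 * k + 2) (c k.castSucc).x).ne'
  have htop : topLaw α α' β M (M + 1) (c (Fin.last M)).x = _ :=
    (topLaw_final hα hα' M _).trans (towerP_eq hα hα' hβ _ _)
  have hstep : ∏ k, step β (c k).z (prevX c k) =
      ∏ k : Fin M, fTildeDet β (n := 2 * ((k : ℕ) + 1)) (c k.castSucc).x (c k.succ).z := by
    rw [Fin.prod_univ_succ]
    have h0 : step β (c 0).z (prevX c 0) = 1 :=
      Finset.prod_of_isEmpty (ι := Fin 0) _
    rw [h0, one_mul]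
    exact Finset.prod_congr rfl fun k _ => (fTildeDet_eq β (n := 2 * ((k : ℕ) + 1)) _ _).symm
  have hschur : (∏ k : Fin (M + 1), schur (towerWeights α α' (2 * k)) (prevX c k)) *
      (∏ k : Fin (M + 1), (schur (towerWeights α α' (2 * k + 2)) (c k).x)⁻¹) =
      (schur (towerWeights α α' (2 * M + 2)) (c (Fin.last M)).x)⁻¹ := by
    rw [Fin.prod_univ_succ, Fin.prod_univ_castSucc (n := M), ← mul_assoc]
    have h0 : schur (towerWeights α α' (2 * ((0 : Fin (M + 1)) : ℕ))) (prevX c 0) = 1 := rfl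
    have h1 : (∏ k : Fin M, schur (towerWeights α α' (2 * (k.succ : ℕ))) (prevX c k.succ)) *
        ∏ k : Fin M, (schur (towerWeights α α' (2 * (k.castSucc : ℕ) + 2)) (c k.castSucc).x)⁻¹ =
        1 := by
      rw [← Finset.prod_mul_distrib]
      exact Finset.prod_eq_one fun k _ => mul_inv_cancel₀ (hpx k)
    rw [h0, one_mul, h1, one_mul]
    rfl
  rw [configLaw, htop]
  simp only [hw, levelLaw_eq hα hα' hβ]
  rw [Finset.prod_mul_distrib, Finset.prod_mul_distrib, Finset.prod_mul_distrib,
    Finset.prod_mul_distrib, Finset.prod_mul_distrib, mul_assoc _ (∏ k, schur _ _), hschur, hstep]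
  field_simp

end Formula

end TowerTiling

end

theorem mainTheorem2 (α α' β : ℝ) (hα : 0 < α) (hα' : 0 < α') (hβ : 0 ≤ β) :
    -- the kernels of the chain are well defined: the limits exist
    (∀ (n : ℕ) (b : ℝ), 0 ≤ b → ∀ x y : TowerTiling.W n,
      Filter.Tendsto (fun a => TowerTiling.genP a b x y) (TowerTiling.towerLimit α α' n)
        (nhds (TowerTiling.towerP α α' b x y))) ∧
    (∀ (n : ℕ) (x : TowerTiling.W (n + 1)) (y : TowerTiling.W n),
      Filter.Tendsto (fun a => TowerTiling.genLink a x y) (TowerTiling.towerLimit α α' (n + 1))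
        (nhds (TowerTiling.towerLink α α' x y))) ∧
    ∀ (N : ℕ) (hN : 1 ≤ N),
      -- the law of the Tower of size `N` is a probability measure
      (∀ c : TowerTiling.Config N, 0 ≤ TowerTiling.towerLaw α α' β N c) ∧
      HasSum (TowerTiling.towerLaw α α' β N) 1 ∧
      -- it is given by the product of determinants
      ∃ C : ℝ, ∀ c : TowerTiling.Config N,
        ((TowerTiling.towerLaw α α' β N c : ℝ) : ℂ) =
          (C : ℂ) *
            TowerTiling.psiTildeDet β (c ⟨N - 1, Nat.sub_lt hN Nat.one_pos⟩).x *
            ((∏ k : Fin N,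
                TowerTiling.phiDet (c k).x (c k).y * TowerTiling.phiDet (c k).y (c k).z : ℝ) : ℂ) *
            ((∏ k : Fin (N - 1),
                TowerTiling.fTildeDet β (n := 2 * ((k : ℕ) + 1))
                  (c ⟨(k : ℕ), by omega⟩).x (c ⟨(k : ℕ) + 1, by omega⟩).z : ℝ) : ℂ) *
            ((∏ k : Fin N, TowerTiling.weightF α α' (c k) : ℝ) : ℂ) := by
  refine ⟨fun n b hb x y => ?_, fun n x y => ?_, fun N hN => ?_⟩
  · rw [TowerTiling.towerP_eq hα hα' hb]
    exact TowerTiling.tendsto_genP hα hα' hb x y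
  · rw [TowerTiling.towerLink_eq hα hα']
    exact TowerTiling.tendsto_genLink hα hα' x y
  · obtain ⟨M, rfl⟩ : ∃ M, N = M + 1 := ⟨N - 1, by omega⟩
    refine ⟨TowerTiling.chainLaw_nonneg hα hα' hβ _, (TowerTiling.chainLaw_mass hα hα' hβ _).2, ?_⟩
    obtain ⟨C, hC⟩ := TowerTiling.exists_configLaw_eq hα hα' hβ M
    -- the sign of the reversal is its own inverse
    set s : ℤ := (Equiv.Perm.sign (Fin.revPerm (n := 2 * M + 2)) : ℤ) with hs
    have hss : (s : ℂ) * s = 1 := by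
      have h : s * s = 1 := congrArg Units.val
        (Int.units_mul_self (Equiv.Perm.sign (Fin.revPerm (n := 2 * M + 2))))
      exact_mod_cast h
    refine ⟨s * C, fun c => ?_⟩
    have hpsi : TowerTiling.psiTildeDet β (c ⟨M + 1 - 1, Nat.sub_lt hN Nat.one_pos⟩).x =
        (s : ℂ) * (TowerTiling.step β (TowerTiling.packed (2 * M + 2)) (c (Fin.last M)).x : ℂ) :=
      TowerTiling.psiTildeDet_eq β (M := 2 * M + 2) (c (Fin.last M)).x
    have hlaw : ((TowerTiling.towerLaw α α' β (M + 1) c : ℝ) : ℂ) =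
        (C : ℂ) * (TowerTiling.step β (TowerTiling.packed (2 * M + 2)) (c (Fin.last M)).x : ℂ) *
          ((∏ k, (TowerTiling.phiDet (c k).x (c k).y * TowerTiling.phiDet (c k).y (c k).z) : ℝ) : ℂ) *
          ((∏ k : Fin M, TowerTiling.fTildeDet β (n := 2 * ((k : ℕ) + 1))
            (c k.castSucc).x (c k.succ).z : ℝ) : ℂ) *
          ((∏ k, TowerTiling.weightF α α' (c k) : ℝ) : ℂ) := by
      rw [TowerTiling.towerLaw, TowerTiling.chainLaw_eq hα hα' hβ, hC]
      norm_cast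
    rw [hpsi, hlaw]
    have hsC : ((s * C : ℝ) : ℂ) * ((s : ℂ) *
        (TowerTiling.step β (TowerTiling.packed (2 * M + 2)) (c (Fin.last M)).x : ℂ)) =
        (C : ℂ) * (TowerTiling.step β (TowerTiling.packed (2 * M + 2)) (c (Fin.last M)).x : ℂ) := by
      push_cast
      linear_combination (C : ℂ) *
        (TowerTiling.step β (TowerTiling.packed (2 * M + 2)) (c (Fin.last M)).x : ℂ) * hss
    rw [hsC]
    rfl
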